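/- **Conventions.** We work in univalent foundations, read in its standard homotopical interpretation, so that "identity" is not strict equality. A *set* has the usual meaning. A *$1$-truncated type* $A$ is a groupoid: its points are the objects, and the identity type $x=_A y$ is the set of morphisms from $x$ to $y$, which we call *identifications*. A function between $1$-truncated types is a functor of groupoids, and it is an equivalence of types iff it is an equivalence of groupoids. A family of sets over $A$ carries a functorial transport along identifications, and dependent functions are compatible with transport. An identification of tuples is a tuple of identifications, the later ones lying over the earlier ones; an identification of functions is a pointwise one, natural in identifications; and an identification of types is an equivalence. *Categories.* A *category* $C$ has a ($1$-truncated) type of objects and a family of hom-sets, with the usual composition and identities. Transporting $\mathrm{id}_x$ along $p:x=y$ gives an isomorphism $\mathsf{idtoiso}(p):x\cong y$. The category $C$ is *univalent* if $\mathsf{idtoiso}:(x=y)\to(x\cong y)$ is a bijection for all objects $x,y$. *Enrichments.* Let $\mathcal V$ be a monoidal category with unit $\mathbb 1$. A *$\mathcal V$-enrichment* $\mathcal E$ of a category $C$ consists of a function $(x,y)\mapsto \mathcal E(x,y)$ from pairs of objects of $C$ to objects of $\mathcal V$; morphisms $e_x:\mathbb 1\to\mathcal E(x,x)$ and $c_{x,y,z}:\mathcal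 E(y,z)\otimes\mathcal E(x,y)\to\mathcal E(x,z)$ satisfying the left unit, right unit and associativity laws; and bijections $f\mapsto\underline f$ from $C(x,y)$ to $\mathcal V(\mathbb 1,\mathcal E(x,y))$ with $\underline{\mathrm{id}_x}=e_x$ and $\underline{g\circ f}=c_{x,y,z}\circ(\underline g\otimes\underline f)\circ\lambda_{\mathbb 1}^{-1}$. *The bicategory $\mathsf{EnrichCat}(\mathcal V)$.* - Its objects are *univalent $\mathcal V$-enriched categories*, that is, univalent categories together with a $\mathcal V$-enrichment. - Its 1-cells $(C_1,\mathcal E_1)\to(C_2,\mathcal E_2)$ are *enriched functors*: functors $F:C_1\to C_2$ together with morphisms $F_{x,y}:\mathcal E_1(x,y)\to\mathcal E_2(Fx,Fy)$ that preserve $e$ and $c$ and satisfy $\underline{F(f)}=F_{x,y}\circ\underline f$. - Its 2-cells $F\Rightarrow G$ are *enriched transformations*: natural transformations $\tau:F\Rightarrow G$ such that, for all $x,y$, the morphisms $c\circ(G_{x,y}\otimes\underline{\tau_x})\circ\rho^{-1}$ and $c\circ(\underline{\tau_y}\otimes F_{x,y})\circ\lambda^{-1}$ from $\mathcal E_1(x,y)$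 to $\mathcal E_2(Fx,Gy)$ are equal. *Univalent bicategories.* A bicategory is *univalent* if it is - *locally univalent*: for all parallel 1-cells $f,g$ the canonical map from the identity type $f=g$ to the set of invertible 2-cells from $f$ to $g$ is a bijection; and - *globally univalent*: for all objects $a,b$ the canonical map from the identity type $a=b$ to the type of adjoint equivalences from $a$ to $b$, which sends reflexivity to the identity adjoint equivalence, is an equivalence of types. **Theorem.** Let $\mathcal V$ be a univalent monoidal category. Then the bicategory $\mathsf{EnrichCat}(\mathcal V)$ is univalent. Explicitly, global univalence says the following. By the conventions above, an identification of univalent enriched categories $(C_1,\mathcal E_1)$ and $(C_2,\mathcal E_2)$ consists of an equivalence between their types of objects; bijections between hom-sets over it that preserve identities and composition; and natural identifications in the type of objects of $\mathcal V$ between the hom-objects over it, along which $e$, $c$ and $f\mapsto\underline f$ are transported to each other. The canonical map from the type of these identifications to the type of adjoint equivalences in $\mathsf{EnrichCat}(\mathcal V)$ is an equivalence. Local univalence says that identifications of enriched functors correspond bijectively to invertible enriched transformations. -/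

import Mathlib

open CategoryTheory MonoidalCategory

universe w₁ v₁ u₁ w v u w₂ v₂ u₂ w₃ v₃ u₃

namespace UF

/-!
# Univalent enriched categories, with types read as homotopy types

The identity type `x = y` of univalent foundations is not Lean's proof-irrelevant equality (for the
latter, the univalence axiom fails).  Types are therefore read in the standard homotopical model of
univalent foundations, in which types are homotopy types.  In low truncation levels this means:

* a set is a Lean type; a `1`-truncated type is a groupoid: its points are the objects of the
  groupoid, the identity type `x = y` is the hom-set `x ⟶ y`, and reflexivity, concatenation and
  reversal of identifications are identities, composition and inverses;
* a function between `1`-truncated types is a functor (its action on morphisms is the action of the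
  function on identifications), and it is an equivalence of types iff the functor is an equivalence;
* a family of sets over a `1`-truncated type has a functorial transport along identifications, and
  a dependent function is a family of elements that is compatible with transport;
* the identity types of `Σ`-types, of `Π`-types and of universes consist of tuples of
  identifications (the later ones over the earlier ones, along transport), of pointwise
  identifications (function extensionality), and of equivalences (the univalence axiom).

The type of objects of a univalent category and the types of enriched functors between univalent
enriched categories are `1`-truncated, and the type of all univalent enriched categories is
`2`-truncated with `1`-truncated identity types, so nothing beyond these levels is needed.

For a univalent monoidal category `V` the action of `⊗` on identifications of objects is determined
by its action on isomorphisms, so it is not recorded separately.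
-/

/-- The points of the type of objects of a category `C`.  The hom-sets of `Pt C` are the identity
types of that type, as opposed to the hom-sets of `C`. -/
@[ext]
structure Pt (C : Type u) where
  /-- the object of `C` -/
  of : C

/-- A category in the sense of univalent foundations (hom-types are sets), whose type of objects is
`1`-truncated: a category `C` together with the identity types of its type of objects.

Transport in the family of sets `(x, y) ↦ (x ⟶ y)` along `p : x = x'` and `q : y = y'` is
`f ↦ (idToHom p)⁻¹ ≫ f ≫ idToHom q`, where `idToHom p` is the transport of `𝟙 x` along `p` in its
codomain; so transport is recorded by the map `idToHom`, which is functorial. -/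
class PathCategory (C : Type u) [Category.{v} C] where
  /-- identifications of objects -/
  groupoid : Groupoid.{w} (Pt C)
  /-- the morphism underlying the isomorphism that an identification induces -/
  idToHom {x y : Pt C} (p : x ⟶ y) : x.of ⟶ y.of
  idToHom_id (x : Pt C) : idToHom (𝟙 x) = 𝟙 x.of
  idToHom_comp {x y z : Pt C} (p : x ⟶ y) (q : y ⟶ z) :
    idToHom (p ≫ q) = idToHom p ≫ idToHom q

attribute [reducible, instance] PathCategory.groupoid
attribute [simp] PathCategory.idToHom_id PathCategory.idToHom_comp

open PathCategory (idToHom)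

section

variable {C : Type u} [Category.{v} C] [PathCategory.{w} C]

@[simp]
lemma PathCategory.idToHom_inv_comp {x y : Pt C} (p : x ⟶ y) :
    idToHom (inv p) ≫ idToHom p = 𝟙 y.of := by
  rw [← PathCategory.idToHom_comp]; simp

@[simp]
lemma PathCategory.idToHom_comp_inv {x y : Pt C} (p : x ⟶ y) :
    idToHom p ≫ idToHom (inv p) = 𝟙 x.of := by
  rw [← PathCategory.idToHom_comp]; simp

@[simp]
lemma PathCategory.idToHom_inv_comp_assoc {x y : Pt C} (p : x ⟶ y) {z : C} (f : y.of ⟶ z) :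
    idToHom (inv p) ≫ idToHom p ≫ f = f := by
  rw [← Category.assoc]; simp

@[simp]
lemma PathCategory.idToHom_comp_inv_assoc {x y : Pt C} (p : x ⟶ y) {z : C} (f : x.of ⟶ z) :
    idToHom p ≫ idToHom (inv p) ≫ f = f := by
  rw [← Category.assoc]; simp

/-- The canonical map from identifications `x = y` to isomorphisms `x ≅ y`. -/
noncomputable def PathCategory.idToIso {x y : Pt C} (p : x ⟶ y) : x.of ≅ y.of where
  hom := idToHom p
  inv := idToHom (inv p)

end

/-- A category is univalent if for all objects `x` and `y` the map from the identity type `x = y` to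
the set of isomorphisms `x ≅ y` is an equivalence. -/
def IsUnivalentCategory (C : Type u) [Category.{v} C] [PathCategory.{w} C] : Prop :=
  ∀ x y : Pt C, Function.Bijective (fun p : x ⟶ y => PathCategory.idToIso p)

section

variable (C : Type u) [Category.{v} C] [PathCategory.{w} C]
  (D : Type u₂) [Category.{v₂} D] [PathCategory.{w₂} D]

/-- A functor: a function between the types of objects (with its action on identifications) and a
dependent family of functions between the hom-sets, preserving identities and composition. -/
structure PathFunctor extends C ⥤ D where
  /-- the action of the function on objects on identifications -/
  mapPath {x y : Pt C} (p : x ⟶ y) : (⟨obj x.of⟩ : Pt D) ⟶ ⟨obj y.of⟩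
  mapPath_id (x : Pt C) : mapPath (𝟙 x) = 𝟙 _ := by cat_disch
  mapPath_comp {x y z : Pt C} (p : x ⟶ y) (q : y ⟶ z) :
    mapPath (p ≫ q) = mapPath p ≫ mapPath q := by cat_disch
  /-- the action on morphisms is compatible with transport -/
  idToHom_mapPath {x y : Pt C} (p : x ⟶ y) : idToHom (mapPath p) = map (idToHom p) := by cat_disch

end

attribute [simp] PathFunctor.mapPath_id PathFunctor.mapPath_comp PathFunctor.idToHom_mapPath

section

variable {C : Type u} [Category.{v} C] [PathCategory.{w} C]
  {D : Type u₂} [Category.{v₂} D] [PathCategory.{w₂} D]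

/-- The function on objects of a functor, as a map of `1`-truncated types. -/
@[simps]
def PathFunctor.onPoints (F : PathFunctor C D) : Pt C ⥤ Pt D where
  obj x := ⟨F.obj x.of⟩
  map p := F.mapPath p

end

/-- A `V`-enrichment of a category `C`.  Composition is
`ecomp x y z : E(y, z) ⊗ E(x, y) ⟶ E(x, z)`. -/
structure Enrichment (V : Type u₁) [Category.{v₁} V] [MonoidalCategory V] [PathCategory.{w₁} V]
    (C : Type u) [Category.{v} C] [PathCategory.{w} C] where
  /-- hom-objects -/
  hom : C → C → V
  /-- the action of the function `(x, y) ↦ E(x, y)` on identifications -/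
  homPath {x x' y y' : Pt C} (p : x ⟶ x') (q : y ⟶ y') :
    (⟨hom x.of y.of⟩ : Pt V) ⟶ ⟨hom x'.of y'.of⟩
  homPath_id (x y : Pt C) : homPath (𝟙 x) (𝟙 y) = 𝟙 _
  homPath_comp {x x' x'' y y' y'' : Pt C} (p : x ⟶ x') (p' : x' ⟶ x'') (q : y ⟶ y')
    (q' : y' ⟶ y'') : homPath (p ≫ p') (q ≫ q') = homPath p q ≫ homPath p' q'
  /-- enriched identity -/
  eid (x : C) : 𝟙_ V ⟶ hom x x
  /-- enriched composition -/
  ecomp (x y z : C) : hom y z ⊗ hom x y ⟶ hom x z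
  /-- from morphisms to elements of the hom-object -/
  fromArr {x y : C} (f : x ⟶ y) : 𝟙_ V ⟶ hom x y
  /-- from elements of the hom-object to morphisms -/
  toArr {x y : C} (f : 𝟙_ V ⟶ hom x y) : x ⟶ y
  fromArr_toArr {x y : C} (f : 𝟙_ V ⟶ hom x y) : fromArr (toArr f) = f
  toArr_fromArr {x y : C} (f : x ⟶ y) : toArr (fromArr f) = f
  eid_ecomp (x y : C) : eid y ▷ hom x y ≫ ecomp x y y = (λ_ (hom x y)).hom
  ecomp_eid (x y : C) : hom x y ◁ eid x ≫ ecomp x x y = (ρ_ (hom x y)).hom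
  assoc (w x y z : C) :
    (α_ (hom y z) (hom x y) (hom w x)).hom ≫ hom y z ◁ ecomp w x y ≫ ecomp w y z =
      ecomp x y z ▷ hom w x ≫ ecomp w x z
  fromArr_id (x : C) : fromArr (𝟙 x) = eid x
  fromArr_comp {x y z : C} (f : x ⟶ y) (g : y ⟶ z) :
    fromArr (f ≫ g) = (λ_ (𝟙_ V)).inv ≫ (fromArr g ⊗ₘ fromArr f) ≫ ecomp x y z
  /-- enriched identities are compatible with transport -/
  eid_homPath {x x' : Pt C} (p : x ⟶ x') : eid x.of ≫ idToHom (homPath p p) = eid x'.of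
  /-- enriched composition is compatible with transport -/
  ecomp_homPath {x x' y y' z z' : Pt C} (p : x ⟶ x') (q : y ⟶ y') (r : z ⟶ z') :
    ecomp x.of y.of z.of ≫ idToHom (homPath p r) =
      (idToHom (homPath q r) ⊗ₘ idToHom (homPath p q)) ≫ ecomp x'.of y'.of z'.of
  /-- `fromArr` (and hence its inverse `toArr`) is compatible with transport -/
  fromArr_homPath {x x' y y' : Pt C} (p : x ⟶ x') (q : y ⟶ y') (f : x.of ⟶ y.of) :
    fromArr f ≫ idToHom (homPath p q) =
      fromArr ((PathCategory.idToIso p).inv ≫ f ≫ (PathCategory.idToIso q).hom)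

/-- A univalent `V`-enriched category: a univalent category together with a `V`-enrichment. -/
structure EnrichCat (V : Type u₁) [Category.{v₁} V] [MonoidalCategory V] [PathCategory.{w₁} V] where
  /-- the underlying type of objects -/
  carrier : Type u
  [category : Category.{v} carrier]
  [paths : PathCategory.{w} carrier]
  univalent : IsUnivalentCategory carrier
  /-- the enrichment -/
  enr : Enrichment V carrier

attribute [instance] EnrichCat.category EnrichCat.paths

attribute [simp] Enrichment.homPath_id Enrichment.homPath_comp Enrichment.fromArr_toArr
  Enrichment.toArr_fromArr Enrichment.eid_ecomp Enrichment.ecomp_eid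

section

variable {V : Type u₁} [Category.{v₁} V] [MonoidalCategory V] [PathCategory.{w₁} V]

/-- An enriched functor: a functor together with an enrichment of it. -/
structure EnrichedFunctor (X Y : EnrichCat.{w₁, v₁, u₁, w, v, u} V) extends
    PathFunctor X.carrier Y.carrier where
  /-- the action on hom-objects -/
  emap (x y : X.carrier) : X.enr.hom x y ⟶ Y.enr.hom (obj x) (obj y)
  eid_emap (x : X.carrier) : X.enr.eid x ≫ emap x x = Y.enr.eid (obj x)
  ecomp_emap (x y z : X.carrier) :
    X.enr.ecomp x y z ≫ emap x z =
      (emap y z ⊗ₘ emap x y) ≫ Y.enr.ecomp (obj x) (obj y) (obj z)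
  fromArr_map {x y : X.carrier} (f : x ⟶ y) :
    Y.enr.fromArr (map f) = X.enr.fromArr f ≫ emap x y
  /-- the action on hom-objects is compatible with transport -/
  emap_homPath {x x' y y' : Pt X.carrier} (p : x ⟶ x') (q : y ⟶ y') :
    emap x.of y.of ≫ idToHom (Y.enr.homPath (mapPath p) (mapPath q)) =
      idToHom (X.enr.homPath p q) ≫ emap x'.of y'.of

/-- An enriched transformation: a natural transformation that is enriched.  (Compatibility of the
components with transport is naturality at the morphisms `idToHom p`.) -/
@[ext]
structure EnrichedTransformation {X Y : EnrichCat.{w₁, v₁, u₁, w, v, u} V}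
    (F G : EnrichedFunctor X Y) extends NatTrans F.toFunctor G.toFunctor where
  enriched (x y : X.carrier) :
    (ρ_ (X.enr.hom x y)).inv ≫ (G.emap x y ⊗ₘ Y.enr.fromArr (app x)) ≫
        Y.enr.ecomp (F.obj x) (G.obj x) (G.obj y) =
      (λ_ (X.enr.hom x y)).inv ≫ (Y.enr.fromArr (app y) ⊗ₘ F.emap x y) ≫
        Y.enr.ecomp (F.obj x) (F.obj y) (G.obj y)

end

section

variable {V : Type u₁} [Category.{v₁} V] [MonoidalCategory V] [PathCategory.{w₁} V]
  {C : Type u} [Category.{v} C] [PathCategory.{w} C]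

namespace Enrichment

variable (E : Enrichment V C)

/-- precomposition with a morphism, on hom-objects -/
def pre {x y : C} (f : x ⟶ y) (z : C) : E.hom y z ⟶ E.hom x z :=
  (ρ_ (E.hom y z)).inv ≫ (E.hom y z ◁ E.fromArr f) ≫ E.ecomp x y z

/-- postcomposition with a morphism, on hom-objects -/
def post (w : C) {x y : C} (f : x ⟶ y) : E.hom w x ⟶ E.hom w y :=
  (λ_ (E.hom w x)).inv ≫ (E.fromArr f ▷ E.hom w x) ≫ E.ecomp w x y

@[simp]
lemma pre_id (x z : C) : E.pre (𝟙 x) z = 𝟙 _ := by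
  simp [pre, E.fromArr_id]

@[simp]
lemma post_id (w x : C) : E.post w (𝟙 x) = 𝟙 _ := by
  simp [post, E.fromArr_id]

@[simp]
lemma pre_comp {x y z : C} (f : x ⟶ y) (g : y ⟶ z) (t : C) :
    E.pre (f ≫ g) t = E.pre g t ≫ E.pre f t := by
  have h := E.assoc x y z t
  have : E.pre g t ≫ E.pre f t = (ρ_ _).inv ≫ (ρ_ _).inv ▷ _ ≫ ((_ ◁ E.fromArr g) ▷ _) ≫
      (_ ◁ E.fromArr f) ≫ (E.ecomp y z t ▷ _ ≫ E.ecomp x y t) := by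
    simp only [pre, Category.assoc]
    rw [whisker_exchange_assoc, ← rightUnitor_inv_naturality_assoc,
      ← rightUnitor_inv_naturality_assoc]
    simp
  rw [this, ← h]
  simp only [pre, E.fromArr_comp, MonoidalCategory.tensorHom_def]
  simp only [MonoidalCategory.whiskerLeft_comp, Category.assoc]
  monoidal

@[simp]
lemma post_comp (w : C) {x y z : C} (f : x ⟶ y) (g : y ⟶ z) :
    E.post w (f ≫ g) = E.post w f ≫ E.post w g := by
  have h := E.assoc w x y z
  have : E.post w f ≫ E.post w g = (λ_ _).inv ≫ _ ◁ (λ_ _).inv ≫ (_ ◁ (E.fromArr f ▷ _)) ≫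
      (E.fromArr g ▷ _) ≫ (_ ◁ E.ecomp w x y ≫ E.ecomp w y z) := by
    simp only [post, Category.assoc]
    rw [← whisker_exchange_assoc, ← leftUnitor_inv_naturality_assoc,
      ← leftUnitor_inv_naturality_assoc]
    simp
  rw [this]
  have h' : E.hom y z ◁ E.ecomp w x y ≫ E.ecomp w y z =
      (α_ (E.hom y z) (E.hom x y) (E.hom w x)).inv ≫ E.ecomp x y z ▷ E.hom w x ≫ E.ecomp w x z := by
    rw [← h]; simp
  rw [h']
  simp only [post, E.fromArr_comp, MonoidalCategory.tensorHom_def']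
  simp only [comp_whiskerRight, Category.assoc]
  monoidal

lemma pre_post {w x y z : C} (f : w ⟶ x) (g : y ⟶ z) :
    E.pre f y ≫ E.post w g = E.post x g ≫ E.pre f z := by
  have h := E.assoc w x y z
  have h1 : E.pre f y ≫ E.post w g = (λ_ _).inv ≫ _ ◁ (ρ_ _).inv ≫ (E.fromArr g ▷ _) ≫
      _ ◁ (_ ◁ E.fromArr f) ≫ (_ ◁ E.ecomp w x y ≫ E.ecomp w y z) := by
    simp only [pre, post, Category.assoc]
    rw [leftUnitor_inv_naturality_assoc, leftUnitor_inv_naturality_assoc,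
      leftUnitor_inv_naturality_assoc]
    rw [whisker_exchange_assoc, whisker_exchange_assoc, whisker_exchange_assoc]
  have h2 : E.post x g ≫ E.pre f z = (ρ_ _).inv ≫ (λ_ _).inv ▷ _ ≫ ((E.fromArr g ▷ _) ▷ _) ≫
      (_ ◁ E.fromArr f) ≫ (E.ecomp x y z ▷ _ ≫ E.ecomp w x z) := by
    simp only [pre, post, Category.assoc]
    rw [whisker_exchange_assoc, ← rightUnitor_inv_naturality_assoc,
      ← rightUnitor_inv_naturality_assoc]
    simp
  rw [h1, h2, ← h]
  monoidal

lemma homPath_eq {x x' y y' : Pt C} (p : x ⟶ x') (q : y ⟶ y') :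
    idToHom (E.homPath p q) = E.pre (idToHom (inv p)) y.of ≫ E.post x'.of (idToHom q) := by
  have hq : idToHom (E.homPath (𝟙 x') q) = E.post x'.of (idToHom q) := by
    have h := E.ecomp_homPath (𝟙 x') (𝟙 y) q
    have e := E.fromArr_homPath (𝟙 y) q (𝟙 y.of)
    simp [PathCategory.idToIso] at h e
    rw [post, ← e, E.fromArr_id, comp_whiskerRight, Category.assoc, ← h]
    simp [← Category.assoc]
  have hp : idToHom (E.homPath p (𝟙 y)) = E.pre (idToHom (inv p)) y.of := by
    have h := E.ecomp_homPath p (𝟙 x) (𝟙 y)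
    have e := E.fromArr_homPath p (𝟙 x) (𝟙 x.of)
    simp [PathCategory.idToIso] at h e
    rw [pre, ← e, E.fromArr_id, MonoidalCategory.whiskerLeft_comp, Category.assoc, ← h]
    simp [← Category.assoc]
  have := E.homPath_comp p (𝟙 x') (𝟙 y) q
  rw [Category.comp_id, Category.id_comp] at this
  rw [this, PathCategory.idToHom_comp, hp, hq]

end Enrichment

lemma EnrichedFunctor.pre_emap {X Y : EnrichCat.{w₁, v₁, u₁, w, v, u} V}
    (F : EnrichedFunctor X Y) {x y : X.carrier} (f : x ⟶ y) (z : X.carrier) :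
    X.enr.pre f z ≫ F.emap x z = F.emap y z ≫ Y.enr.pre (F.map f) (F.obj z) := by
  simp only [Enrichment.pre, Category.assoc, F.ecomp_emap, F.fromArr_map]
  rw [rightUnitor_inv_naturality_assoc]
  simp [MonoidalCategory.tensorHom_def, whisker_exchange_assoc]

lemma EnrichedFunctor.post_emap {X Y : EnrichCat.{w₁, v₁, u₁, w, v, u} V}
    (F : EnrichedFunctor X Y) (w : X.carrier) {x y : X.carrier} (f : x ⟶ y) :
    X.enr.post w f ≫ F.emap w y = F.emap w x ≫ Y.enr.post (F.obj w) (F.map f) := by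
  simp only [Enrichment.post, Category.assoc, F.ecomp_emap, F.fromArr_map]
  rw [leftUnitor_inv_naturality_assoc]
  simp [MonoidalCategory.tensorHom_def', ← whisker_exchange_assoc]

lemma enriched_iff {X Y : EnrichCat.{w₁, v₁, u₁, w, v, u} V} (F G : EnrichedFunctor X Y)
    {x y : X.carrier} (s : F.obj x ⟶ G.obj x) (t : F.obj y ⟶ G.obj y) :
    ((ρ_ (X.enr.hom x y)).inv ≫ (G.emap x y ⊗ₘ Y.enr.fromArr s) ≫
        Y.enr.ecomp (F.obj x) (G.obj x) (G.obj y) =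
      (λ_ (X.enr.hom x y)).inv ≫ (Y.enr.fromArr t ⊗ₘ F.emap x y) ≫
        Y.enr.ecomp (F.obj x) (F.obj y) (G.obj y)) ↔
    G.emap x y ≫ Y.enr.pre s (G.obj y) = F.emap x y ≫ Y.enr.post (F.obj x) t := by
  simp only [Enrichment.pre, Enrichment.post]
  rw [rightUnitor_inv_naturality_assoc, leftUnitor_inv_naturality_assoc]
  rw [MonoidalCategory.tensorHom_def, MonoidalCategory.tensorHom_def']
  simp

lemma EnrichedTransformation.pre_app {X Y : EnrichCat.{w₁, v₁, u₁, w, v, u} V}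
    {F G : EnrichedFunctor X Y} (τ : EnrichedTransformation F G) (x y : X.carrier) :
    G.emap x y ≫ Y.enr.pre (τ.app x) (G.obj y) = F.emap x y ≫ Y.enr.post (F.obj x) (τ.app y) :=
  (enriched_iff F G _ _).1 (τ.enriched x y)

end

/-! ## The bicategory of univalent enriched categories -/

section

variable {V : Type u₁} [Category.{v₁} V] [MonoidalCategory V] [PathCategory.{w₁} V]

namespace EnrichedFunctor

/-- The identity enriched functor. -/
def id (X : EnrichCat.{w₁, v₁, u₁, w, v, u} V) : EnrichedFunctor X X where
  toFunctor := 𝟭 X.carrier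
  mapPath p := p
  emap x y := 𝟙 _
  eid_emap := by simp
  ecomp_emap := by simp
  fromArr_map := by simp
  emap_homPath := by intros; simp

/-- Composition of enriched functors. -/
def comp {X Y Z : EnrichCat.{w₁, v₁, u₁, w, v, u} V} (F : EnrichedFunctor X Y)
    (G : EnrichedFunctor Y Z) : EnrichedFunctor X Z where
  toFunctor := F.toFunctor ⋙ G.toFunctor
  mapPath p := G.mapPath (F.mapPath p)
  mapPath_id x := by rw [F.mapPath_id, G.mapPath_id]; rfl
  emap x y := F.emap x y ≫ G.emap _ _
  eid_emap x := by
    rw [← Category.assoc, F.eid_emap, G.eid_emap]; rfl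
  ecomp_emap x y z := by
    rw [← Category.assoc, F.ecomp_emap, Category.assoc, G.ecomp_emap]; simp
  fromArr_map f := by
    simp [G.fromArr_map, F.fromArr_map]
  emap_homPath p q := by
    rw [← Category.assoc, ← F.emap_homPath, Category.assoc, Category.assoc, ← G.emap_homPath]

end EnrichedFunctor

namespace EnrichCat

/-- The identity enriched transformation. -/
def idTransformation {X Y : EnrichCat.{w₁, v₁, u₁, w, v, u} V} (F : EnrichedFunctor X Y) :
    EnrichedTransformation F F where
  app x := 𝟙 _
  enriched x y := by rw [enriched_iff]; simp

/-- Vertical composition of enriched transformations. -/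
def compTransformation {X Y : EnrichCat.{w₁, v₁, u₁, w, v, u} V} {F G H : EnrichedFunctor X Y}
    (σ : EnrichedTransformation F G) (τ : EnrichedTransformation G H) :
    EnrichedTransformation F H where
  app x := σ.app x ≫ τ.app x
  naturality x y f := by rw [← Category.assoc, σ.naturality, Category.assoc, τ.naturality,
    Category.assoc]
  enriched x y := by
    rw [enriched_iff]
    simp only [Enrichment.pre_comp, Enrichment.post_comp]
    rw [← Category.assoc, τ.pre_app, Category.assoc, ← Enrichment.pre_post,
      ← Category.assoc, σ.pre_app, Category.assoc]

instance (X Y : EnrichCat.{w₁, v₁, u₁, w, v, u} V) : Category (EnrichedFunctor X Y) where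
  Hom F G := EnrichedTransformation F G
  id F := idTransformation F
  comp σ τ := compTransformation σ τ
  id_comp τ := EnrichedTransformation.ext (funext fun x => Category.id_comp (τ.app x))
  comp_id τ := EnrichedTransformation.ext (funext fun x => Category.comp_id (τ.app x))
  assoc ρ σ τ := EnrichedTransformation.ext
    (funext fun x => Category.assoc (ρ.app x) (σ.app x) (τ.app x))

instance : CategoryStruct (EnrichCat.{w₁, v₁, u₁, w, v, u} V) where
  Hom X Y := EnrichedFunctor X Y
  id X := EnrichedFunctor.id X
  comp F G := EnrichedFunctor.comp F G

/-- Left whiskering. -/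
def whiskerLeft {X Y Z : EnrichCat.{w₁, v₁, u₁, w, v, u} V} (F : EnrichedFunctor X Y)
    {G H : EnrichedFunctor Y Z} (τ : EnrichedTransformation G H) :
    EnrichedTransformation (F.comp G) (F.comp H) where
  toNatTrans := Functor.whiskerLeft F.toFunctor τ.toNatTrans
  enriched x y := by
    rw [enriched_iff]
    simp only [EnrichedFunctor.comp, Functor.whiskerLeft_app, Functor.comp_obj, Category.assoc]
    rw [τ.pre_app]

/-- Right whiskering. -/
def whiskerRight {X Y Z : EnrichCat.{w₁, v₁, u₁, w, v, u} V} {F G : EnrichedFunctor X Y}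
    (τ : EnrichedTransformation F G) (H : EnrichedFunctor Y Z) :
    EnrichedTransformation (F.comp H) (G.comp H) where
  toNatTrans := Functor.whiskerRight τ.toNatTrans H.toFunctor
  enriched x y := by
    rw [enriched_iff]
    simp only [EnrichedFunctor.comp, Functor.whiskerRight_app, Functor.comp_obj, Category.assoc]
    rw [← H.pre_emap, ← H.post_emap, ← Category.assoc, τ.pre_app, Category.assoc]

/-- The invertible enriched transformation with identity components. -/
def isoOfId {X Y : EnrichCat.{w₁, v₁, u₁, w, v, u} V} {F G : EnrichedFunctor X Y}
    (τ : EnrichedTransformation F G) (σ : EnrichedTransformation G F)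
    (h : ∀ x, τ.app x ≫ σ.app x = 𝟙 _) (h' : ∀ x, σ.app x ≫ τ.app x = 𝟙 _) : F ≅ G where
  hom := τ
  inv := σ
  hom_inv_id := EnrichedTransformation.ext (funext h)
  inv_hom_id := EnrichedTransformation.ext (funext h')

/-- The associator. -/
def associator {W X Y Z : EnrichCat.{w₁, v₁, u₁, w, v, u} V} (F : EnrichedFunctor W X)
    (G : EnrichedFunctor X Y) (H : EnrichedFunctor Y Z) :
    (F.comp G).comp H ≅ F.comp (G.comp H) :=
  isoOfId
    { toNatTrans := (Functor.associator F.toFunctor G.toFunctor H.toFunctor).hom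
      enriched x y := by
        rw [enriched_iff]; simp [EnrichedFunctor.comp] }
    { toNatTrans := (Functor.associator F.toFunctor G.toFunctor H.toFunctor).inv
      enriched x y := by
        rw [enriched_iff]; simp [EnrichedFunctor.comp] }
    (fun x => Category.id_comp (𝟙 (H.obj (G.obj (F.obj x)))))
    (fun x => Category.id_comp (𝟙 (H.obj (G.obj (F.obj x)))))

/-- The left unitor. -/
def leftUnitor {X Y : EnrichCat.{w₁, v₁, u₁, w, v, u} V} (F : EnrichedFunctor X Y) :
    (EnrichedFunctor.id X).comp F ≅ F :=
  isoOfId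
    { toNatTrans := (Functor.leftUnitor F.toFunctor).hom
      enriched x y := by
        rw [enriched_iff]; simp [EnrichedFunctor.comp, EnrichedFunctor.id] }
    { toNatTrans := (Functor.leftUnitor F.toFunctor).inv
      enriched x y := by
        rw [enriched_iff]; simp [EnrichedFunctor.comp, EnrichedFunctor.id] }
    (fun x => Category.id_comp (𝟙 (F.obj x)))
    (fun x => Category.id_comp (𝟙 (F.obj x)))

/-- The right unitor. -/
def rightUnitor {X Y : EnrichCat.{w₁, v₁, u₁, w, v, u} V} (F : EnrichedFunctor X Y) :
    F.comp (EnrichedFunctor.id Y) ≅ F :=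
  isoOfId
    { toNatTrans := (Functor.rightUnitor F.toFunctor).hom
      enriched x y := by
        rw [enriched_iff]; simp [EnrichedFunctor.comp, EnrichedFunctor.id] }
    { toNatTrans := (Functor.rightUnitor F.toFunctor).inv
      enriched x y := by
        rw [enriched_iff]; simp [EnrichedFunctor.comp, EnrichedFunctor.id] }
    (fun x => Category.id_comp (𝟙 (F.obj x)))
    (fun x => Category.id_comp (𝟙 (F.obj x)))

lemma ext₂ {X Y : EnrichCat.{w₁, v₁, u₁, w, v, u} V} {F G : EnrichedFunctor X Y}
    {σ τ : EnrichedTransformation F G} (h : ∀ x, σ.app x = τ.app x) : σ = τ :=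
  EnrichedTransformation.ext (funext h)

instance : Bicategory (EnrichCat.{w₁, v₁, u₁, w, v, u} V) where
  homCategory X Y := inferInstanceAs (Category (EnrichedFunctor X Y))
  whiskerLeft F _ _ τ := whiskerLeft F τ
  whiskerRight τ H := whiskerRight τ H
  associator F G H := associator F G H
  leftUnitor F := leftUnitor F
  rightUnitor F := rightUnitor F
  whiskerLeft_id _ _ := rfl
  whiskerLeft_comp _ _ _ _ _ _ := rfl
  id_whiskerLeft η := ext₂ fun x =>
    ((Category.id_comp _).trans (Category.comp_id _)).symm
  comp_whiskerLeft F G _ _ η := ext₂ fun x =>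
    ((Category.id_comp _).trans (Category.comp_id _)).symm
  id_whiskerRight F G := ext₂ fun x => G.map_id (F.obj x)
  comp_whiskerRight η θ H := ext₂ fun x => H.map_comp (η.app x) (θ.app x)
  whiskerRight_id η := ext₂ fun x =>
    ((Category.id_comp _).trans (Category.comp_id _)).symm
  whiskerRight_comp η _ _ := ext₂ fun x =>
    ((Category.id_comp _).trans (Category.comp_id _)).symm
  whisker_assoc F _ _ η H := ext₂ fun x =>
    ((Category.id_comp _).trans (Category.comp_id _)).symm
  whisker_exchange η θ := ext₂ fun x => (θ.naturality (η.app x)).symm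
  pentagon F G H I := ext₂ fun x => by
    change I.map (𝟙 (H.obj (G.obj (F.obj x)))) ≫ 𝟙 _ ≫ 𝟙 _ = 𝟙 _ ≫ 𝟙 _
    simp
  triangle F G := ext₂ fun x =>
    (Category.comp_id (𝟙 (G.obj (F.obj x)))).trans (G.map_id (F.obj x)).symm

end EnrichCat

end

/-! ## Univalent bicategories -/

/-- Identity types of the 1-cells of a bicategory in the sense of univalent foundations: each
hom-category is a category in that sense, with a `1`-truncated type of 1-cells. -/
class LocalPaths (B : Type u) [Bicategory.{w, v} B] where
  homPaths (a b : B) : PathCategory.{w₂} (a ⟶ b)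

attribute [reducible, instance] LocalPaths.homPaths

section

open Bicategory

variable {B : Type u} [Bicategory.{w, v} B] [LocalPaths.{w, v, u, w₂} B]

/-- The type of adjoint equivalences from `a` to `b`. -/
structure AdjEquiv (a b : B) where
  /-- the underlying adjoint equivalence -/
  eqv : Bicategory.Equivalence a b

/-- Identifications of adjoint equivalences, that is, of tuples consisting of two 1-cells, a unit and
a counit: identifications of the 1-cells in both directions along which unit and counit are
transported to unit and counit. -/
@[ext]
structure AdjEquiv.Ident {a b : B} (e e' : AdjEquiv a b) where
  hom : (⟨e.eqv.hom⟩ : Pt (a ⟶ b)) ⟶ ⟨e'.eqv.hom⟩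
  inv : (⟨e.eqv.inv⟩ : Pt (b ⟶ a)) ⟶ ⟨e'.eqv.inv⟩
  unit : e.eqv.unit.hom ≫ idToHom hom ▷ e.eqv.inv ≫ e'.eqv.hom ◁ idToHom inv = e'.eqv.unit.hom
  counit : idToHom inv ▷ e.eqv.hom ≫ e'.eqv.inv ◁ idToHom hom ≫ e'.eqv.counit.hom =
    e.eqv.counit.hom

/-- The type of adjoint equivalences as a `1`-truncated type. -/
noncomputable instance AdjEquiv.groupoid (a b : B) : Groupoid (AdjEquiv a b) where
  Hom e e' := AdjEquiv.Ident e e'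
  id e := { hom := 𝟙 _, inv := 𝟙 _, unit := by simp, counit := by simp }
  comp {e₁ e₂ e₃} p q :=
    { hom := p.hom ≫ q.hom
      inv := p.inv ≫ q.inv
      unit := by
        rw [← q.unit, ← p.unit]
        simp [Bicategory.whisker_exchange_assoc]
      counit := by
        rw [← p.counit, ← q.counit]
        simp [Bicategory.whisker_exchange_assoc] }
  id_comp p := AdjEquiv.Ident.ext (Category.id_comp _) (Category.id_comp _)
  comp_id p := AdjEquiv.Ident.ext (Category.comp_id _) (Category.comp_id _)
  assoc p q r := AdjEquiv.Ident.ext (Category.assoc _ _ _) (Category.assoc _ _ _)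
  inv {e e'} p :=
    { hom := CategoryTheory.inv p.hom
      inv := CategoryTheory.inv p.inv
      unit := by
        rw [← p.unit]
        have h : idToHom p.hom ▷ e.eqv.inv ≫ e'.eqv.hom ◁ idToHom p.inv =
          e.eqv.hom ◁ idToHom p.inv ≫ idToHom p.hom ▷ e'.eqv.inv :=
            (Bicategory.whisker_exchange _ _).symm
        rw [h]
        simp only [Category.assoc]
        rw [← Bicategory.comp_whiskerRight_assoc, PathCategory.idToHom_comp_inv,
          Bicategory.id_whiskerRight, Category.id_comp, ← Bicategory.whiskerLeft_comp,
          PathCategory.idToHom_comp_inv, Bicategory.whiskerLeft_id, Category.comp_id]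
      counit := by
        rw [← p.counit]
        have h : idToHom p.inv ▷ e.eqv.hom ≫ e'.eqv.inv ◁ idToHom p.hom =
          e.eqv.inv ◁ idToHom p.hom ≫ idToHom p.inv ▷ e'.eqv.hom :=
            (Bicategory.whisker_exchange _ _).symm
        rw [← Category.assoc (idToHom p.inv ▷ e.eqv.hom), h]
        simp only [Category.assoc]
        rw [← Bicategory.whiskerLeft_comp_assoc, PathCategory.idToHom_inv_comp,
          Bicategory.whiskerLeft_id, Category.id_comp, ← Bicategory.comp_whiskerRight_assoc,
          PathCategory.idToHom_inv_comp, Bicategory.id_whiskerRight, Category.id_comp] }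
  inv_comp p := AdjEquiv.Ident.ext (IsIso.inv_hom_id p.hom) (IsIso.inv_hom_id p.inv)
  comp_inv p := AdjEquiv.Ident.ext (IsIso.hom_inv_id p.hom) (IsIso.hom_inv_id p.inv)

end

/-- The identity types of a bicategory in the sense of univalent foundations, and the canonical map
from identifications of objects to adjoint equivalences. -/
class PathBicategory (B : Type u) [Bicategory.{w, v} B] extends LocalPaths.{w, v, u, w₂} B where
  /-- identifications of objects -/
  ObId : B → B → Type u₃
  /-- the identity type of two objects is `1`-truncated -/
  [groupoid (a b : B) : Groupoid.{v₃} (ObId a b)]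
  /-- reflexivity -/
  refl (a : B) : ObId a a
  /-- the canonical map from the identity type `a = b` to the type of adjoint equivalences -/
  idToAdjEquiv (a b : B) : ObId a b ⥤ AdjEquiv a b
  /-- reflexivity is sent to the identity adjoint equivalence -/
  idToAdjEquiv_refl (a : B) :
    Nonempty ((idToAdjEquiv a a).obj (refl a) ⟶ ⟨Bicategory.Equivalence.id a⟩)

attribute [reducible, instance] PathBicategory.groupoid

/-- A bicategory is locally univalent if for all parallel 1-cells `f` and `g` the map from the
identity type `f = g` to the type of invertible 2-cells `f ≅ g` is an equivalence. -/
def IsLocallyUnivalent (B : Type u) [Bicategory.{w, v} B] [PathBicategory.{w, v, u, w₂, v₃, u₃} B] :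
    Prop :=
  ∀ a b : B, IsUnivalentCategory (a ⟶ b)

/-- A bicategory is globally univalent if for all objects `a` and `b` the map from the identity type
`a = b` to the type of adjoint equivalences from `a` to `b` is an equivalence. -/
def IsGloballyUnivalent (B : Type u) [Bicategory.{w, v} B]
    [PathBicategory.{w, v, u, w₂, v₃, u₃} B] : Prop :=
  ∀ a b : B, (PathBicategory.idToAdjEquiv a b).IsEquivalence

/-- A bicategory is univalent if it is both locally and globally univalent. -/
def IsUnivalentBicategory (B : Type u) [Bicategory.{w, v} B]
    [PathBicategory.{w, v, u, w₂, v₃, u₃} B] : Prop :=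
  IsLocallyUnivalent B ∧ IsGloballyUnivalent B

/-! ## Identity types of enriched functors and of univalent enriched categories -/

section

variable {V : Type u₁} [Category.{v₁} V] [MonoidalCategory V] [PathCategory.{w₁} V]

/-- Identifications of enriched functors `F` and `G`: pointwise identifications of the functions on
objects, natural with respect to identifications, along which the actions on morphisms and on
hom-objects are transported to each other. -/
@[ext]
structure EnrichedFunctor.Ident {X Y : EnrichCat.{w₁, v₁, u₁, w, v, u} V}
    (F G : EnrichedFunctor X Y) where
  app (x : X.carrier) : (⟨F.obj x⟩ : Pt Y.carrier) ⟶ ⟨G.obj x⟩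
  natural {x y : Pt X.carrier} (p : x ⟶ y) : F.mapPath p ≫ app y.of = app x.of ≫ G.mapPath p
  map_transport {x y : X.carrier} (f : x ⟶ y) :
    F.map f ≫ idToHom (app y) = idToHom (app x) ≫ G.map f
  emap_transport (x y : X.carrier) :
    F.emap x y ≫ idToHom (Y.enr.homPath (app x) (app y)) = G.emap x y

namespace EnrichedFunctor

/-- The type of enriched functors as a `1`-truncated type. -/
noncomputable instance groupoid (X Y : EnrichCat.{w₁, v₁, u₁, w, v, u} V) :
    Groupoid (Pt (EnrichedFunctor X Y)) where
  Hom F G := EnrichedFunctor.Ident F.of G.of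
  id F :=
    { app x := 𝟙 _
      natural p := by simp
      map_transport f := by simp
      emap_transport x y := by simp }
  comp {F G H} s t :=
    { app x := s.app x ≫ t.app x
      natural p := by
        rw [← Category.assoc, s.natural, Category.assoc, t.natural, Category.assoc]
      map_transport f := by
        simp only [PathCategory.idToHom_comp]
        rw [← Category.assoc, s.map_transport, Category.assoc, t.map_transport, Category.assoc]
      emap_transport x y := by
        rw [Y.enr.homPath_comp, PathCategory.idToHom_comp, ← Category.assoc, s.emap_transport,
          t.emap_transport] }
  id_comp s := EnrichedFunctor.Ident.ext (funext fun x => Category.id_comp (s.app x))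
  comp_id s := EnrichedFunctor.Ident.ext (funext fun x => Category.comp_id (s.app x))
  assoc r s t := EnrichedFunctor.Ident.ext
    (funext fun x => Category.assoc (r.app x) (s.app x) (t.app x))
  inv {F G} s :=
    { app x := inv (s.app x)
      natural p := by
        rw [IsIso.eq_inv_comp, ← Category.assoc, ← s.natural, Category.assoc, IsIso.hom_inv_id,
          Category.comp_id]
      map_transport {x y} f := by
        have h := s.map_transport f
        calc _ = (idToHom (inv (s.app x)) ≫ idToHom (s.app x)) ≫ G.of.map f ≫
              idToHom (inv (s.app y)) := by simp
          _ = idToHom (inv (s.app x)) ≫ (idToHom (s.app x) ≫ G.of.map f) ≫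
              idToHom (inv (s.app y)) := by simp only [Category.assoc]
          _ = _ := by rw [← h]; simp
      emap_transport x y := by
        rw [← s.emap_transport, Category.assoc, ← PathCategory.idToHom_comp,
          ← Y.enr.homPath_comp]
        simp }
  inv_comp s := EnrichedFunctor.Ident.ext (funext fun x => IsIso.inv_hom_id (s.app x))
  comp_inv s := EnrichedFunctor.Ident.ext (funext fun x => IsIso.hom_inv_id (s.app x))

/-- The enriched transformation induced by an identification of enriched functors. -/
def Ident.toTransformation {X Y : EnrichCat.{w₁, v₁, u₁, w, v, u} V}
    {F G : EnrichedFunctor X Y} (s : F.Ident G) : EnrichedTransformation F G where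
  app x := idToHom (s.app x)
  naturality _ _ f := s.map_transport f
  enriched x y := by
    rw [enriched_iff, ← s.emap_transport, Y.enr.homPath_eq, Category.assoc, Category.assoc,
      ← Enrichment.pre_post, ← Category.assoc (Enrichment.pre _ _ _), ← Enrichment.pre_comp]
    simp

noncomputable instance (X Y : EnrichCat.{w₁, v₁, u₁, w, v, u} V) :
    PathCategory (EnrichedFunctor X Y) where
  groupoid := groupoid X Y
  idToHom s := Ident.toTransformation s
  idToHom_id F := EnrichCat.ext₂ fun x => PathCategory.idToHom_id _
  idToHom_comp s t := EnrichCat.ext₂ fun x => PathCategory.idToHom_comp (s.app x) (t.app x)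

end EnrichedFunctor

namespace EnrichCat

noncomputable instance : LocalPaths (EnrichCat.{w₁, v₁, u₁, w, v, u} V) where
  homPaths X Y := inferInstanceAs (PathCategory (EnrichedFunctor X Y))

/-- Identifications of univalent enriched categories `X` and `Y`: an equivalence between the types
of objects, bijections between the hom-sets over it that are compatible with transport and preserve
identities and composition, and identifications between the hom-objects over it that are natural
with respect to identifications and along which the operations `eid`, `ecomp`, `fromArr` (and hence
its inverse `toArr`) of the enrichments are transported to each other. -/
structure Ident (X Y : EnrichCat.{w₁, v₁, u₁, w, v, u} V) extends
    PathFunctor X.carrier Y.carrier where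
  isEquivalence : toPathFunctor.onPoints.IsEquivalence
  bijective (x y : X.carrier) : Function.Bijective (fun f : x ⟶ y => map f)
  /-- identifications of hom-objects -/
  homId (x y : X.carrier) : (⟨X.enr.hom x y⟩ : Pt V) ⟶ ⟨Y.enr.hom (obj x) (obj y)⟩
  homId_natural {x x' y y' : Pt X.carrier} (p : x ⟶ x') (q : y ⟶ y') :
    X.enr.homPath p q ≫ homId x'.of y'.of =
      homId x.of y.of ≫ Y.enr.homPath (mapPath p) (mapPath q)
  eid_transport (x : X.carrier) : X.enr.eid x ≫ idToHom (homId x x) = Y.enr.eid (obj x)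
  ecomp_transport (x y z : X.carrier) :
    X.enr.ecomp x y z ≫ idToHom (homId x z) =
      (idToHom (homId y z) ⊗ₘ idToHom (homId x y)) ≫ Y.enr.ecomp (obj x) (obj y) (obj z)
  fromArr_transport {x y : X.carrier} (f : x ⟶ y) :
    X.enr.fromArr f ≫ idToHom (homId x y) = Y.enr.fromArr (map f)

/-- Identifications of identifications of univalent enriched categories: pointwise identifications
of the functions on objects, natural with respect to identifications, along which the actions on
morphisms and the identifications of hom-objects are transported to each other. -/
@[ext]
structure Ident₂ {X Y : EnrichCat.{w₁, v₁, u₁, w, v, u} V} (P Q : Ident X Y) where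
  app (x : X.carrier) : (⟨P.obj x⟩ : Pt Y.carrier) ⟶ ⟨Q.obj x⟩
  natural {x y : Pt X.carrier} (p : x ⟶ y) : P.mapPath p ≫ app y.of = app x.of ≫ Q.mapPath p
  map_transport {x y : X.carrier} (f : x ⟶ y) :
    P.map f ≫ idToHom (app y) = idToHom (app x) ≫ Q.map f
  homId_transport (x y : X.carrier) :
    P.homId x y ≫ Y.enr.homPath (app x) (app y) = Q.homId x y

/-- The identity type of two univalent enriched categories as a `1`-truncated type. -/
noncomputable instance (X Y : EnrichCat.{w₁, v₁, u₁, w, v, u} V) : Groupoid (Ident X Y) where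
  Hom P Q := Ident₂ P Q
  id P :=
    { app x := 𝟙 _
      natural p := by simp
      map_transport f := by simp
      homId_transport x y := by simp }
  comp {P Q R} s t :=
    { app x := s.app x ≫ t.app x
      natural p := by
        rw [← Category.assoc, s.natural, Category.assoc, t.natural, Category.assoc]
      map_transport f := by
        simp only [PathCategory.idToHom_comp]
        rw [← Category.assoc, s.map_transport, Category.assoc, t.map_transport, Category.assoc]
      homId_transport x y := by
        rw [Y.enr.homPath_comp, ← Category.assoc, s.homId_transport, t.homId_transport] }
  id_comp s := Ident₂.ext (funext fun x => Category.id_comp (s.app x))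
  comp_id s := Ident₂.ext (funext fun x => Category.comp_id (s.app x))
  assoc r s t := Ident₂.ext (funext fun x => Category.assoc (r.app x) (s.app x) (t.app x))
  inv {P Q} s :=
    { app x := inv (s.app x)
      natural p := by
        rw [IsIso.eq_inv_comp, ← Category.assoc, ← s.natural, Category.assoc, IsIso.hom_inv_id,
          Category.comp_id]
      map_transport {x y} f := by
        have h := s.map_transport f
        calc _ = (idToHom (inv (s.app x)) ≫ idToHom (s.app x)) ≫ Q.map f ≫
              idToHom (inv (s.app y)) := by simp
          _ = idToHom (inv (s.app x)) ≫ (idToHom (s.app x) ≫ Q.map f) ≫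
              idToHom (inv (s.app y)) := by simp only [Category.assoc]
          _ = _ := by rw [← h]; simp
      homId_transport x y := by
        rw [← s.homId_transport, Category.assoc, ← Y.enr.homPath_comp]
        simp }
  inv_comp s := Ident₂.ext (funext fun x => IsIso.inv_hom_id (s.app x))
  comp_inv s := Ident₂.ext (funext fun x => IsIso.hom_inv_id (s.app x))

end EnrichCat

end

/-! ## The map from identifications to adjoint equivalences -/

section

variable {V : Type u₁} [Category.{v₁} V] [MonoidalCategory V] [PathCategory.{w₁} V]

namespace EnrichCat.Ident

variable {X Y : EnrichCat.{w₁, v₁, u₁, w, v, u} V}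

/-- The enriched functor underlying an identification: transport of the identity. -/
def toEnrichedFunctor (P : Ident X Y) : EnrichedFunctor X Y where
  toPathFunctor := P.toPathFunctor
  emap x y := idToHom (P.homId x y)
  eid_emap := P.eid_transport
  ecomp_emap := P.ecomp_transport
  fromArr_map f := (P.fromArr_transport f).symm
  emap_homPath p q := by
    rw [← PathCategory.idToHom_comp, ← PathCategory.idToHom_comp, P.homId_natural]

/-- A (half-adjoint) inverse of the function on objects of an identification. -/
structure Inverse (P : Ident X Y) where
  obj : Y.carrier → X.carrier
  path {y y' : Pt Y.carrier} (p : y ⟶ y') : (⟨obj y.of⟩ : Pt X.carrier) ⟶ ⟨obj y'.of⟩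
  path_id (y : Pt Y.carrier) : path (𝟙 y) = 𝟙 _
  path_comp {y y' y'' : Pt Y.carrier} (p : y ⟶ y') (q : y' ⟶ y'') :
    path (p ≫ q) = path p ≫ path q
  ε (y : Y.carrier) : (⟨P.obj (obj y)⟩ : Pt Y.carrier) ⟶ ⟨y⟩
  η (x : X.carrier) : (⟨x⟩ : Pt X.carrier) ⟶ ⟨obj (P.obj x)⟩
  ε_natural {y y' : Pt Y.carrier} (p : y ⟶ y') : P.mapPath (path p) ≫ ε y'.of = ε y.of ≫ p
  η_natural {x x' : Pt X.carrier} (p : x ⟶ x') : p ≫ η x'.of = η x.of ≫ path (P.mapPath p)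
  η_ε (x : X.carrier) : P.mapPath (η x) ≫ ε (P.obj x) = 𝟙 _

/-- The inverse of the equivalence between the types of objects. -/
noncomputable def inverse (P : Ident X Y) : P.Inverse :=
  have := P.isEquivalence
  let e : Pt X.carrier ≌ Pt Y.carrier := P.onPoints.asEquivalence
  { obj y := (e.inverse.obj ⟨y⟩).of
    path p := e.inverse.map p
    path_id y := e.inverse.map_id y
    path_comp p q := e.inverse.map_comp p q
    ε y := e.counit.app ⟨y⟩
    η x := e.unit.app ⟨x⟩
    ε_natural p := e.counit.naturality p
    η_natural p := e.unit.naturality p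
    η_ε x := e.functor_unit_comp ⟨x⟩ }

/-- The inverse function on objects. -/
noncomputable abbrev invObj (P : Ident X Y) (y : Y.carrier) : X.carrier := P.inverse.obj y

/-- The action of the inverse function on identifications. -/
noncomputable abbrev invPath (P : Ident X Y) {y y' : Pt Y.carrier} (p : y ⟶ y') :
    (⟨P.invObj y.of⟩ : Pt X.carrier) ⟶ ⟨P.invObj y'.of⟩ := P.inverse.path p

/-- The inverse function is a section. -/
noncomputable abbrev ε (P : Ident X Y) (y : Y.carrier) :
    (⟨P.obj (P.invObj y)⟩ : Pt Y.carrier) ⟶ ⟨y⟩ := P.inverse.ε y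

/-- The inverse function is a retraction. -/
noncomputable abbrev η (P : Ident X Y) (x : X.carrier) :
    (⟨x⟩ : Pt X.carrier) ⟶ ⟨P.invObj (P.obj x)⟩ := P.inverse.η x

lemma ε_natural (P : Ident X Y) {y y' : Pt Y.carrier} (p : y ⟶ y') :
    P.mapPath (P.invPath p) ≫ P.ε y'.of = P.ε y.of ≫ p := P.inverse.ε_natural p

lemma η_natural (P : Ident X Y) {x x' : Pt X.carrier} (p : x ⟶ x') :
    p ≫ P.η x'.of = P.η x.of ≫ P.invPath (P.mapPath p) := P.inverse.η_natural p

lemma η_ε (P : Ident X Y) (x : X.carrier) : P.mapPath (P.η x) ≫ P.ε (P.obj x) = 𝟙 _ :=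
  P.inverse.η_ε x

lemma mapPath_injective (P : Ident X Y) {x y : Pt X.carrier} {p q : x ⟶ y}
    (h : P.mapPath p = P.mapPath q) : p = q :=
  have := P.isEquivalence
  P.onPoints.map_injective h

lemma map_injective (P : Ident X Y) {x y : X.carrier} {f g : x ⟶ y} (h : P.map f = P.map g) :
    f = g :=
  (P.bijective x y).1 h

noncomputable def invMap (P : Ident X Y) {y y' : Y.carrier} (f : y ⟶ y') :
    P.invObj y ⟶ P.invObj y' :=
  ((P.bijective _ _).2 (idToHom (P.ε y) ≫ f ≫ idToHom (inv (P.ε y')))).choose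

lemma map_invMap (P : Ident X Y) {y y' : Y.carrier} (f : y ⟶ y') :
    P.map (P.invMap f) = idToHom (P.ε y) ≫ f ≫ idToHom (inv (P.ε y')) :=
  ((P.bijective _ _).2 (idToHom (P.ε y) ≫ f ≫ idToHom (inv (P.ε y')))).choose_spec

/-- The inverse identification of hom-objects. -/
noncomputable def invHomId (P : Ident X Y) (y y' : Y.carrier) :
    (⟨Y.enr.hom y y'⟩ : Pt V) ⟶ ⟨X.enr.hom (P.invObj y) (P.invObj y')⟩ :=
  Y.enr.homPath (inv (P.ε y)) (inv (P.ε y')) ≫ inv (P.homId _ _)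

lemma invHomId_homId (P : Ident X Y) (y y' : Y.carrier) :
    P.invHomId y y' ≫ P.homId _ _ = Y.enr.homPath (inv (P.ε y)) (inv (P.ε y')) := by
  simp [invHomId]

lemma tr_invHomId_homId (P : Ident X Y) (y y' : Y.carrier) :
    idToHom (P.invHomId y y') ≫ idToHom (P.homId _ _) =
      idToHom (Y.enr.homPath (inv (P.ε y)) (inv (P.ε y'))) := by
  rw [← PathCategory.idToHom_comp, invHomId_homId]

lemma cancel_homId (P : Ident X Y) {x y : X.carrier} {v : V} {f g : v ⟶ X.enr.hom x y}
    (h : f ≫ idToHom (P.homId x y) = g ≫ idToHom (P.homId x y)) : f = g := by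
  have := congrArg (· ≫ idToHom (inv (P.homId x y))) h
  simpa using this

/-- The inverse enriched functor. -/
noncomputable def invFunctor (P : Ident X Y) : EnrichedFunctor Y X where
  obj := P.invObj
  map f := P.invMap f
  map_id y := P.map_injective (by rw [map_invMap]; simp)
  map_comp f g := P.map_injective (by simp [map_invMap])
  mapPath p := P.invPath p
  mapPath_id y := P.inverse.path_id y
  mapPath_comp p q := P.inverse.path_comp p q
  idToHom_mapPath {y y'} p := P.map_injective (by
    rw [map_invMap, ← P.idToHom_mapPath, ← PathCategory.idToHom_comp, ← PathCategory.idToHom_comp,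
      ← Category.assoc, ← ε_natural]
    simp)
  emap y y' := idToHom (P.invHomId y y')
  eid_emap y := P.cancel_homId (by
    rw [Category.assoc, tr_invHomId_homId, P.eid_transport, Y.enr.eid_homPath])
  ecomp_emap x y z := P.cancel_homId (by
    rw [Category.assoc, tr_invHomId_homId, Category.assoc, P.ecomp_transport,
      Y.enr.ecomp_homPath _ (inv (P.ε y)), tensorHom_comp_tensorHom_assoc, tr_invHomId_homId,
      tr_invHomId_homId])
  fromArr_map {x y} f := P.cancel_homId (by
    rw [P.fromArr_transport, map_invMap, Category.assoc, tr_invHomId_homId,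
      Y.enr.fromArr_homPath]
    simp [PathCategory.idToIso])
  emap_homPath {x x' y y'} p q := by
    rw [← PathCategory.idToHom_comp, ← PathCategory.idToHom_comp]
    congr 1
    rw [← cancel_mono (P.homId _ _), Category.assoc, P.homId_natural, ← Category.assoc,
      invHomId_homId, Category.assoc, invHomId_homId, ← Y.enr.homPath_comp, ← Y.enr.homPath_comp]
    congr 1
    · rw [IsIso.inv_comp_eq, ← Category.assoc, ← P.ε_natural]; simp
    · rw [IsIso.inv_comp_eq, ← Category.assoc, ← P.ε_natural]; simp

lemma mapPath_η (P : Ident X Y) (x : X.carrier) : P.mapPath (P.η x) = inv (P.ε (P.obj x)) := by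
  rw [← cancel_mono (P.ε (P.obj x)), η_ε]; simp

lemma map_η (P : Ident X Y) (x : X.carrier) :
    P.map (idToHom (P.η x)) = idToHom (inv (P.ε (P.obj x))) := by
  rw [← P.idToHom_mapPath, mapPath_η]

lemma η_map (P : Ident X Y) {x y : X.carrier} (f : x ⟶ y) :
    f ≫ idToHom (P.η y) = idToHom (P.η x) ≫ P.invMap (P.map f) := P.map_injective (by
  rw [P.map_comp, P.map_comp, map_η, map_η, map_invMap]; simp)

lemma ε_map (P : Ident X Y) {x y : Y.carrier} (f : x ⟶ y) :
    P.map (P.invMap f) ≫ idToHom (P.ε y) = idToHom (P.ε x) ≫ f := by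
  rw [map_invMap, Category.assoc, Category.assoc, PathCategory.idToHom_inv_comp, Category.comp_id]

lemma η_homId (P : Ident X Y) (x y : X.carrier) :
    X.enr.homPath (P.η x) (P.η y) = P.homId x y ≫ P.invHomId (P.obj x) (P.obj y) := by
  rw [← cancel_mono (P.homId _ _), P.homId_natural, Category.assoc, invHomId_homId, mapPath_η,
    mapPath_η]

lemma ε_homId (P : Ident X Y) (x y : Y.carrier) :
    P.invHomId x y ≫ P.homId _ _ ≫ Y.enr.homPath (P.ε x) (P.ε y) = 𝟙 _ := by
  rw [← Category.assoc, invHomId_homId, ← Y.enr.homPath_comp]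
  simp

/-- The unit, as an identification of enriched functors. -/
noncomputable def unitId (P : Ident X Y) :
    (EnrichedFunctor.id X).Ident (P.toEnrichedFunctor.comp P.invFunctor) where
  app x := P.η x
  natural p := P.η_natural p
  map_transport f := P.η_map f
  emap_transport x y := by
    have h := congrArg (fun p => idToHom p) (P.η_homId x y)
    exact (Category.id_comp _).trans (h.trans (PathCategory.idToHom_comp _ _))

/-- The counit, as an identification of enriched functors. -/
noncomputable def counitId (P : Ident X Y) :
    (P.invFunctor.comp P.toEnrichedFunctor).Ident (EnrichedFunctor.id Y) where
  app y := P.ε y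
  natural p := P.ε_natural p
  map_transport f := P.ε_map f
  emap_transport x y := by
    have h := congrArg (fun p => idToHom p) (P.ε_homId x y)
    rw [PathCategory.idToHom_comp, PathCategory.idToHom_comp, PathCategory.idToHom_id,
      ← Category.assoc] at h
    exact h

lemma leftZigzag_eq {B : Type u} [Bicategory.{w, v} B] {a b : B} {f : a ⟶ b} {g : b ⟶ a}
    (η : 𝟙 a ⟶ f ≫ g) (ε : g ≫ f ⟶ 𝟙 b) :
    Bicategory.leftZigzag η ε = Bicategory.whiskerRight η f ≫ (Bicategory.associator f g f).hom ≫
      Bicategory.whiskerLeft f ε := by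
  simp [Bicategory.leftZigzag, bicategoricalComp]

/-- The adjoint equivalence induced by an identification. -/
noncomputable def toEquivalence (P : Ident X Y) : Bicategory.Equivalence X Y where
  hom := P.toEnrichedFunctor
  inv := P.invFunctor
  unit := PathCategory.idToIso (C := X ⟶ X)
    (x := ⟨𝟙 X⟩) (y := ⟨P.toEnrichedFunctor.comp P.invFunctor⟩) P.unitId
  counit := PathCategory.idToIso (C := Y ⟶ Y)
    (x := ⟨P.invFunctor.comp P.toEnrichedFunctor⟩) (y := ⟨𝟙 Y⟩) P.counitId
  left_triangle := by
    apply Iso.ext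
    change Bicategory.leftZigzag _ _ = _
    rw [leftZigzag_eq]
    refine EnrichCat.ext₂ fun x => ?_
    have h : P.map (idToHom (P.η x)) ≫ idToHom (P.ε (P.obj x)) = 𝟙 _ := by
      rw [map_η]; simp
    change P.map (idToHom (P.η x)) ≫ 𝟙 _ ≫ idToHom (P.ε (P.obj x)) = 𝟙 _ ≫ 𝟙 _
    rw [Category.id_comp, Category.id_comp, h]

lemma inv_ident_unique (Q : Ident X Y) {x y : X.carrier} {p q : (⟨x⟩ : Pt X.carrier) ⟶ ⟨y⟩} {z}
    {e : (⟨Q.obj y⟩ : Pt Y.carrier) ⟶ z} (h : Q.mapPath p ≫ e = Q.mapPath q ≫ e) : p = q :=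
  Q.mapPath_injective ((cancel_mono e).1 h)

lemma mapPath_surjective (P : Ident X Y) {x y : X.carrier}
    (q : (⟨P.obj x⟩ : Pt Y.carrier) ⟶ ⟨P.obj y⟩) :
    ∃ p : (⟨x⟩ : Pt X.carrier) ⟶ ⟨y⟩, P.mapPath p = q :=
  have := P.isEquivalence
  ⟨P.onPoints.preimage (X := Pt.mk x) (Y := Pt.mk y) q, P.onPoints.map_preimage (X := Pt.mk x) (Y := Pt.mk y) q⟩

/-- The identification of the inverse functions on objects that is induced by an identification of
identifications. -/
noncomputable def invApp {P Q : Ident X Y} (s : Ident₂ P Q) (y : Y.carrier) :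
    (⟨P.invObj y⟩ : Pt X.carrier) ⟶ ⟨Q.invObj y⟩ :=
  (Q.mapPath_surjective (inv (s.app (P.invObj y)) ≫ P.ε y ≫ inv (Q.ε y))).choose

lemma mapPath_invApp {P Q : Ident X Y} (s : Ident₂ P Q) (y : Y.carrier) :
    s.app (P.invObj y) ≫ Q.mapPath (invApp s y) ≫ Q.ε y = P.ε y := by
  have h : Q.mapPath (invApp s y) = inv (s.app (P.invObj y)) ≫ P.ε y ≫ inv (Q.ε y) :=
    (Q.mapPath_surjective (inv (s.app (P.invObj y)) ≫ P.ε y ≫ inv (Q.ε y))).choose_spec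
  rw [h]; simp

lemma invApp_natural {P Q : Ident X Y} (s : Ident₂ P Q) {y y' : Pt Y.carrier} (p : y ⟶ y') :
    P.invPath p ≫ invApp s y'.of = invApp s y.of ≫ Q.invPath p := by
  refine Q.inv_ident_unique (e := Q.ε y'.of) ?_
  rw [← cancel_epi (s.app (P.invObj y.of)), Q.mapPath_comp, Q.mapPath_comp,
    Category.assoc, Category.assoc, Q.ε_natural]
  have h := s.natural (P.invPath p)
  have h1 := mapPath_invApp s y.of
  have h2 := mapPath_invApp s y'.of
  calc _ = (s.app (P.invObj y.of) ≫ Q.mapPath (P.invPath p)) ≫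
        Q.mapPath (invApp s y'.of) ≫ Q.ε y'.of := (Category.assoc _ _ _).symm
    _ = P.mapPath (P.invPath p) ≫ s.app (P.invObj y'.of) ≫
        Q.mapPath (invApp s y'.of) ≫ Q.ε y'.of := by rw [← h, Category.assoc]
    _ = P.ε y.of ≫ p := by rw [h2, P.ε_natural]
    _ = _ := by rw [← h1]; simp only [Category.assoc]

lemma invApp_map {P Q : Ident X Y} (s : Ident₂ P Q) {y y' : Y.carrier} (f : y ⟶ y') :
    P.invMap f ≫ idToHom (invApp s y') = idToHom (invApp s y) ≫ Q.invMap f := by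
  refine Q.map_injective ?_
  rw [Q.map_comp, Q.map_comp, ← Q.idToHom_mapPath, ← Q.idToHom_mapPath]
  have h := s.map_transport (P.invMap f)
  have h1 := congrArg (fun p => idToHom p) (mapPath_invApp s y)
  have h2 := congrArg (fun p => idToHom p) (mapPath_invApp s y')
  simp only [PathCategory.idToHom_comp] at h1 h2
  have c1 : Function.Injective (fun g : Q.obj (P.invObj y) ⟶ Q.obj (Q.invObj y') =>
      idToHom (s.app (P.invObj y)) ≫ g ≫ idToHom (Q.ε y')) := by
    intro g g' e
    have e' := congrArg (fun k => idToHom (inv (s.app (P.invObj y))) ≫ k ≫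
      idToHom (inv (Q.ε y'))) e
    simpa using e'
  refine c1 ?_
  change idToHom (s.app (P.invObj y)) ≫ (_ ≫ _) ≫ _ = idToHom (s.app (P.invObj y)) ≫ (_ ≫ _) ≫ _
  calc _ = (idToHom (s.app (P.invObj y)) ≫ Q.map (P.invMap f)) ≫
        idToHom (Q.mapPath (invApp s y')) ≫ idToHom (Q.ε y') := by simp only [Category.assoc]
    _ = P.map (P.invMap f) ≫ idToHom (s.app (P.invObj y')) ≫
        idToHom (Q.mapPath (invApp s y')) ≫ idToHom (Q.ε y') := by rw [← h, Category.assoc]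
    _ = idToHom (P.ε y) ≫ f := by rw [h2, P.ε_map]
    _ = _ := by rw [Category.assoc, Q.ε_map, ← h1]; simp only [Category.assoc]

lemma invApp_homId {P Q : Ident X Y} (s : Ident₂ P Q) (y y' : Y.carrier) :
    P.invHomId y y' ≫ X.enr.homPath (invApp s y) (invApp s y') = Q.invHomId y y' := by
  rw [← cancel_mono (Q.homId _ _), invHomId_homId, Category.assoc, Q.homId_natural,
    ← s.homId_transport, Category.assoc, ← Y.enr.homPath_comp, ← Category.assoc, invHomId_homId,
    ← Y.enr.homPath_comp]
  congr 1
  · rw [IsIso.inv_comp_eq, ← cancel_mono (Q.ε y), Category.assoc, Category.assoc, mapPath_invApp]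
    simp
  · rw [IsIso.inv_comp_eq, ← cancel_mono (Q.ε y'), Category.assoc, Category.assoc, mapPath_invApp]
    simp

lemma invApp_unique {P Q : Ident X Y} (s : Ident₂ P Q) (y : Y.carrier)
    (t : (⟨P.invObj y⟩ : Pt X.carrier) ⟶ ⟨Q.invObj y⟩)
    (h : s.app (P.invObj y) ≫ Q.mapPath t ≫ Q.ε y = P.ε y) : invApp s y = t := by
  refine Q.inv_ident_unique (e := Q.ε y) ?_
  rw [← cancel_epi (s.app (P.invObj y)), mapPath_invApp, h]

/-- The enriched functors underlying identified identifications are identified. -/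
def homId₂ {P Q : Ident X Y} (s : Ident₂ P Q) : P.toEnrichedFunctor.Ident Q.toEnrichedFunctor where
  app x := s.app x
  natural p := s.natural p
  map_transport f := s.map_transport f
  emap_transport x y := by
    have h := congrArg (fun p => idToHom p) (s.homId_transport x y)
    exact (PathCategory.idToHom_comp _ _).symm.trans h

/-- The inverses of identified identifications are identified. -/
noncomputable def invId₂ {P Q : Ident X Y} (s : Ident₂ P Q) : P.invFunctor.Ident Q.invFunctor where
  app y := invApp s y
  natural p := invApp_natural s p
  map_transport f := invApp_map s f
  emap_transport y y' := by
    have h := congrArg (fun p => idToHom p) (invApp_homId s y y')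
    exact (PathCategory.idToHom_comp _ _).symm.trans h

lemma unit_invApp {P Q : Ident X Y} (s : Ident₂ P Q) (x : X.carrier) :
    P.η x ≫ P.invPath (s.app x) ≫ invApp s (Q.obj x) = Q.η x := by
  refine Q.inv_ident_unique (e := Q.ε (Q.obj x)) ?_
  rw [Q.η_ε, invApp_natural s (s.app x), Q.mapPath_comp, Q.mapPath_comp, Category.assoc,
    Category.assoc, Q.ε_natural, ← cancel_epi (s.app x)]
  have h := s.natural (P.η x)
  have h1 := mapPath_invApp s (P.obj x)
  calc _ = (s.app x ≫ Q.mapPath (P.η x)) ≫ Q.mapPath (invApp s (P.obj x)) ≫ Q.ε (P.obj x) ≫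
        s.app x := by simp only [Category.assoc]
    _ = P.mapPath (P.η x) ≫ (s.app (P.invObj (P.obj x)) ≫ Q.mapPath (invApp s (P.obj x)) ≫
        Q.ε (P.obj x)) ≫ s.app x := by rw [← h]; simp only [Category.assoc]
    _ = (P.mapPath (P.η x) ≫ P.ε (P.obj x)) ≫ s.app x := by rw [h1, Category.assoc]
    _ = _ := by rw [P.η_ε]; simp

/-- The identification of the adjoint equivalences induced by identified identifications. -/
noncomputable def adjEquivId {P Q : Ident X Y} (s : Ident₂ P Q) :
    (⟨P.toEquivalence⟩ : AdjEquiv X Y).Ident ⟨Q.toEquivalence⟩ where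
  hom := homId₂ s
  inv := invId₂ s
  unit := EnrichCat.ext₂ fun x => by
    change idToHom (P.η x) ≫ P.invMap (idToHom (s.app x)) ≫ idToHom (invApp s (Q.obj x)) =
      idToHom (Q.η x)
    have h1 : P.invMap (idToHom (s.app x)) = idToHom (P.invPath (s.app x)) :=
      (P.invFunctor.idToHom_mapPath (s.app x)).symm
    rw [h1, ← PathCategory.idToHom_comp, ← PathCategory.idToHom_comp, unit_invApp]
  counit := EnrichCat.ext₂ fun y => by
    change P.map (idToHom (invApp s y)) ≫ idToHom (s.app (Q.invObj y)) ≫ idToHom (Q.ε y) =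
      idToHom (P.ε y)
    rw [← Category.assoc, s.map_transport, ← Q.idToHom_mapPath, Category.assoc,
      ← PathCategory.idToHom_comp, ← PathCategory.idToHom_comp, mapPath_invApp]

/-- The canonical map from the identity type of two univalent enriched categories to the type of
adjoint equivalences between them. -/
noncomputable def toAdjEquiv (X Y : EnrichCat.{w₁, v₁, u₁, w, v, u} V) :
    Ident X Y ⥤ AdjEquiv X Y where
  obj P := ⟨P.toEquivalence⟩
  map s := adjEquivId s
  map_id P := AdjEquiv.Ident.ext rfl (EnrichedFunctor.Ident.ext (funext fun y =>
    invApp_unique _ _ _ (by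
      change 𝟙 _ ≫ P.mapPath (𝟙 _) ≫ P.ε y = P.ε y
      simp)))
  map_comp {P Q R} s t := AdjEquiv.Ident.ext rfl (EnrichedFunctor.Ident.ext (funext fun y =>
    invApp_unique _ _ _ (by
      change (Ident₂.app s _ ≫ Ident₂.app t _) ≫ R.mapPath (invApp s y ≫ invApp t y) ≫ R.ε y =
        P.ε y
      have h := t.natural (invApp s y)
      have h1 := mapPath_invApp s y
      have h2 := mapPath_invApp t y
      calc _ = Ident₂.app s (P.invObj y) ≫ (Ident₂.app t (P.invObj y) ≫ R.mapPath (invApp s y)) ≫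
            R.mapPath (invApp t y) ≫ R.ε y := by
              rw [R.mapPath_comp]; simp only [Category.assoc]
        _ = Ident₂.app s (P.invObj y) ≫ Q.mapPath (invApp s y) ≫ Ident₂.app t (Q.invObj y) ≫
            R.mapPath (invApp t y) ≫ R.ε y := by rw [← h]; simp only [Category.assoc]
        _ = P.ε y := by rw [h2, h1])))

/-- Reflexivity. -/
def refl (X : EnrichCat.{w₁, v₁, u₁, w, v, u} V) : Ident X X where
  toFunctor := 𝟭 X.carrier
  mapPath p := p
  isEquivalence := (inferInstance : (𝟭 (Pt X.carrier)).IsEquivalence)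
  bijective x y := Function.bijective_id
  homId x y := 𝟙 _
  homId_natural p q := by simp
  eid_transport x := by simp
  ecomp_transport x y z := by simp
  fromArr_transport f := by simp

lemma toAdjEquiv_refl (X : EnrichCat.{w₁, v₁, u₁, w, v, u} V) :
    Nonempty ((toAdjEquiv X X).obj (refl X) ⟶ ⟨Bicategory.Equivalence.id X⟩) := by
  let P := refl X
  refine ⟨⟨⟨fun x => 𝟙 _, fun p => ?_, fun f => ?_, fun x y => ?_⟩,
    ⟨fun y => P.ε y, fun p => P.ε_natural p, fun f => P.ε_map f, fun x y => ?_⟩,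
    EnrichCat.ext₂ fun x => ?_, EnrichCat.ext₂ fun y => ?_⟩⟩
  · exact (Category.comp_id p).trans (Category.id_comp p).symm
  · change f ≫ idToHom (𝟙 _) = idToHom (𝟙 _) ≫ f
    simp
  · change idToHom (𝟙 _) ≫ idToHom (X.enr.homPath (𝟙 _) (𝟙 _)) = 𝟙 _
    simp
  · have h := P.ε_homId x y
    change P.invHomId x y ≫ 𝟙 _ ≫ X.enr.homPath (P.ε x) (P.ε y) = 𝟙 _ at h
    rw [Category.id_comp] at h
    have h' := congrArg (fun p => idToHom p) h
    rw [PathCategory.idToHom_comp, PathCategory.idToHom_id] at h'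
    exact h'
  · change idToHom (P.η x) ≫ P.invFunctor.map (idToHom (𝟙 _)) ≫ idToHom (P.ε x) = 𝟙 x
    have h : P.η x ≫ P.ε x = 𝟙 _ := P.η_ε x
    rw [PathCategory.idToHom_id]
    erw [P.invFunctor.map_id]
    erw [Category.id_comp]
    have h' := congrArg (fun p => idToHom p) h
    exact (PathCategory.idToHom_comp _ _).symm.trans (h'.trans (PathCategory.idToHom_id _))
  · change idToHom (P.ε y) ≫ idToHom (𝟙 _) ≫ 𝟙 _ = idToHom (P.ε y)
    simp

end EnrichCat.Ident

noncomputable instance : PathBicategory (EnrichCat.{w₁, v₁, u₁, w, v, u} V) where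
  ObId X Y := EnrichCat.Ident X Y
  refl X := EnrichCat.Ident.refl X
  idToAdjEquiv X Y := EnrichCat.Ident.toAdjEquiv X Y
  idToAdjEquiv_refl X := EnrichCat.Ident.toAdjEquiv_refl X

end

end UF

/-!
An identification of objects in a univalent category is the same as an isomorphism, so every
structure made of identifications can be produced from, and compared through, isomorphisms.

*Local univalence.*  A family of identifications in `Y` corresponds to a family of isomorphisms.
Naturality of the latter gives naturality of the former, because `idToHom` is injective.  The
transport of hom-objects along identifications `p` and `q` is precomposition with the inverse of `p`
followed by postcomposition with `q` (`Enrichment.homPath_eq`); hence a transformation is enriched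
exactly when the corresponding identifications transport the actions on hom-objects to each other
(`EnrichedFunctor.Ident.ofIso`).

*Global univalence.*  The canonical functor from identifications to adjoint equivalences is faithful,
since an identification of identifications is determined by its components.  It is full, since an
identification between the inverse functors is determined by the compatibility with the counits
(`EnrichCat.Ident.invApp_unique`).  It is essentially surjective: the enriched functor `F` underlying
an adjoint equivalence is fully faithful, and its action on hom-objects is invertible
(`EnrichedFunctor.isIso_emap`), so univalence of `V` turns this action into identifications of
hom-objects (`EnrichCat.Ident.ofEnrichedFunctor`).  The adjoint equivalence induced by the resulting
identification has the same underlying enriched functor `F`, and its inverse is identified with the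
given one by uniqueness of right adjoints and local univalence
(`EnrichCat.Ident.nonempty_ident_of_hom_eq`).
-/

namespace UF

open PathCategory (idToHom)

/-! ### Univalent categories -/

namespace IsUnivalentCategory

variable {C : Type u} [Category.{v} C] [PathCategory.{w} C]

lemma idToHom_injective (h : IsUnivalentCategory C) {x y : Pt C} {p q : x ⟶ y}
    (e : idToHom p = idToHom q) : p = q :=
  (h x y).1 (Iso.ext e)

lemma exists_idToHom_eq (h : IsUnivalentCategory C) {x y : C} (f : x ⟶ y) [IsIso f] :
    ∃ p : (⟨x⟩ : Pt C) ⟶ ⟨y⟩, idToHom p = f := by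
  obtain ⟨p, hp⟩ := (h ⟨x⟩ ⟨y⟩).2 (asIso f)
  exact ⟨p, congrArg Iso.hom hp⟩

/-- The identification of objects corresponding to an isomorphism. -/
noncomputable def homToId (h : IsUnivalentCategory C) {x y : C} (f : x ⟶ y) [IsIso f] :
    (⟨x⟩ : Pt C) ⟶ ⟨y⟩ :=
  (h.exists_idToHom_eq f).choose

@[simp]
lemma idToHom_homToId (h : IsUnivalentCategory C) {x y : C} (f : x ⟶ y) [IsIso f] :
    idToHom (h.homToId f) = f :=
  (h.exists_idToHom_eq f).choose_spec

end IsUnivalentCategory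

variable {V : Type u₁} [Category.{v₁} V] [MonoidalCategory V] [PathCategory.{w₁} V]

/-! ### Local univalence -/

namespace EnrichedFunctor

variable {X Y : EnrichCat.{w₁, v₁, u₁, w, v, u} V} {F G : EnrichedFunctor X Y}

@[simp]
lemma iso_hom_inv_app (τ : F ≅ G) (x : X.carrier) : τ.hom.app x ≫ τ.inv.app x = 𝟙 (F.obj x) :=
  congrArg (fun σ : EnrichedTransformation F F => σ.app x) τ.hom_inv_id

@[simp]
lemma iso_inv_hom_app (τ : F ≅ G) (x : X.carrier) : τ.inv.app x ≫ τ.hom.app x = 𝟙 (G.obj x) :=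
  congrArg (fun σ : EnrichedTransformation G G => σ.app x) τ.inv_hom_id

/-- The components of an invertible enriched transformation. -/
@[simps]
def isoApp (τ : F ≅ G) (x : X.carrier) : F.obj x ≅ G.obj x where
  hom := τ.hom.app x
  inv := τ.inv.app x

instance (τ : F ≅ G) (x : X.carrier) : IsIso (τ.hom.app x) :=
  (isoApp τ x).isIso_hom

/-- The identification of enriched functors corresponding to an invertible enriched
transformation. -/
noncomputable def Ident.ofIso (τ : F ≅ G) : F.Ident G where
  app x := Y.univalent.homToId (τ.hom.app x)
  natural {x y} p := Y.univalent.idToHom_injective (by simp)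
  map_transport f := by simp
  emap_transport x y := by
    have h : idToHom (inv (Y.univalent.homToId (τ.hom.app x))) = τ.inv.app x := by
      rw [← cancel_epi (τ.hom.app x), iso_hom_inv_app]
      simpa using PathCategory.idToHom_comp_inv (Y.univalent.homToId (τ.hom.app x))
    rw [Y.enr.homPath_eq, h, Y.univalent.idToHom_homToId, Enrichment.pre_post,
      ← Category.assoc, ← τ.hom.pre_app, Category.assoc, ← Enrichment.pre_comp]
    simp

theorem isUnivalentCategory (X Y : EnrichCat.{w₁, v₁, u₁, w, v, u} V) :
    IsUnivalentCategory (EnrichedFunctor X Y) := by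
  refine fun F G => ⟨fun s t h => Ident.ext (funext fun x => ?_), fun τ => ⟨Ident.ofIso τ, ?_⟩⟩
  · exact Y.univalent.idToHom_injective
      (congrArg (fun σ : F.of ≅ G.of => σ.hom.app x) h)
  · exact Iso.ext (EnrichCat.ext₂ fun x => Y.univalent.idToHom_homToId (τ.hom.app x))

end EnrichedFunctor

/-! ### Equivalences of enriched categories -/

namespace Enrichment

variable {C : Type u} [Category.{v} C] [PathCategory.{w} C] (E : Enrichment V C)

instance {x y : C} (f : x ⟶ y) [IsIso f] (z : C) : IsIso (E.pre f z) :=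
  ⟨E.pre (inv f) z, by rw [← pre_comp]; simp, by rw [← pre_comp]; simp⟩

instance (w : C) {x y : C} (f : x ⟶ y) [IsIso f] : IsIso (E.post w f) :=
  ⟨E.post w (inv f), by rw [← post_comp]; simp, by rw [← post_comp]; simp⟩

end Enrichment

namespace EnrichedFunctor

variable {X Y : EnrichCat.{w₁, v₁, u₁, w, v, u} V}

lemma isIso_emap_of_iso_id {F : EnrichedFunctor X X} (τ : EnrichedFunctor.id X ≅ F)
    (x y : X.carrier) : IsIso (F.emap x y) := by
  have h := τ.hom.pre_app x y
  have : IsIso (F.emap x y ≫ X.enr.pre (τ.hom.app x) (F.obj y)) := by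
    rw [h]
    -- `EnrichedFunctor.id X` acts on hom-objects by identities.
    change IsIso (𝟙 _ ≫ X.enr.post x (τ.hom.app y))
    rw [Category.id_comp]
    change IsIso (X.enr.post ((EnrichedFunctor.id X).obj x) (τ.hom.app y))
    infer_instance
  exact IsIso.of_isIso_comp_right _ (X.enr.pre (τ.hom.app x) (F.obj y))

/-- The action of an equivalence on hom-objects is invertible, by the two-out-of-six property for the
actions of `F`, `G` and `F`. -/
lemma isIso_emap {F : EnrichedFunctor X Y} {G : EnrichedFunctor Y X}
    (η : EnrichedFunctor.id X ≅ F.comp G) (ε : G.comp F ≅ EnrichedFunctor.id Y)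
    (x y : X.carrier) : IsIso (F.emap x y) := by
  have h₁ : IsIso (F.emap x y ≫ G.emap (F.obj x) (F.obj y)) := isIso_emap_of_iso_id η x y
  have h₂ : IsIso (G.emap (F.obj x) (F.obj y) ≫ F.emap _ _) :=
    isIso_emap_of_iso_id ε.symm (F.obj x) (F.obj y)
  -- By `h₁` and `h₂` the action of `G` is a split epimorphism and a monomorphism.
  have : Mono (G.emap (F.obj x) (F.obj y)) := mono_of_mono _ (F.emap _ _)
  have : IsSplitEpi (G.emap (F.obj x) (F.obj y)) :=
    ⟨⟨inv (F.emap x y ≫ G.emap (F.obj x) (F.obj y)) ≫ F.emap x y, by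
      rw [Category.assoc, IsIso.inv_hom_id]⟩⟩
  have : IsIso (G.emap (F.obj x) (F.obj y)) := isIso_of_mono_of_isSplitEpi _
  exact IsIso.of_isIso_comp_right _ (G.emap (F.obj x) (F.obj y))

lemma isEquivalence_toFunctor {F : EnrichedFunctor X Y} {G : EnrichedFunctor Y X}
    (η : EnrichedFunctor.id X ≅ F.comp G) (ε : G.comp F ≅ EnrichedFunctor.id Y) :
    F.toFunctor.IsEquivalence :=
  (CategoryTheory.Equivalence.mk F.toFunctor G.toFunctor
    (NatIso.ofComponents (fun x => isoApp η x) fun f => η.hom.naturality f)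
    (NatIso.ofComponents (fun y => isoApp ε y)
      fun f => ε.hom.naturality f)).isEquivalence_functor

/-- On univalent categories, an equivalence of categories is an equivalence of the types of objects,
since identifications are isomorphisms. -/
lemma isEquivalence_onPoints (F : EnrichedFunctor X Y) [F.toFunctor.IsEquivalence] :
    F.toPathFunctor.onPoints.IsEquivalence where
  faithful := ⟨fun {x y p q} h => X.univalent.idToHom_injective (F.toFunctor.map_injective (by
    rw [← F.idToHom_mapPath, ← F.idToHom_mapPath]
    exact congrArg (fun r => idToHom r) h))⟩
  full := ⟨fun {x y} q => by
    let f := F.toFunctor.preimage (X := x.of) (Y := y.of) (idToHom q)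
    have hf : F.map f = idToHom q := F.toFunctor.map_preimage _
    have : IsIso (F.map f) := by
      rw [hf]; exact (PathCategory.idToIso q).isIso_hom
    have : IsIso f := isIso_of_reflects_iso f F.toFunctor
    refine ⟨X.univalent.homToId f, Y.univalent.idToHom_injective ?_⟩
    change idToHom (F.mapPath _) = _
    rw [F.idToHom_mapPath, X.univalent.idToHom_homToId, hf]⟩
  essSurj := ⟨fun y => ⟨⟨F.toFunctor.objPreimage y.of⟩,
    ⟨(Groupoid.isoEquivHom _ _).symm
      (Y.univalent.homToId (F.toFunctor.objObjPreimageIso y.of).hom)⟩⟩⟩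

end EnrichedFunctor

/-! ### Uniqueness of inverses of an equivalence -/

section

variable {C : Type u} [Category.{v} C] {D : Type u₂} [Category.{v₂} D] {F : C ⥤ D} {G G' : D ⥤ C}
  (η : 𝟭 C ⟶ F ⋙ G) (ε : G ⋙ F ⟶ 𝟭 D) (η' : 𝟭 C ⟶ F ⋙ G') (ε' : G' ⋙ F ⟶ 𝟭 D)

/-- The comparison `G' ⟶ G' F G ⟶ G` takes the unit `η'` to `η`, by the left triangle identity for
`η'` and `ε'`. -/
lemma unit_app_comp_comparison
    (h' : ∀ x, F.map (η'.app x) ≫ ε'.app (F.obj x) = 𝟙 (F.obj x)) (x : C) :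
    η'.app x ≫ η.app (G'.obj (F.obj x)) ≫ G.map (ε'.app (F.obj x)) = η.app x := by
  have hn : η'.app x ≫ η.app (G'.obj (F.obj x)) = η.app x ≫ G.map (F.map (η'.app x)) :=
    η.naturality (η'.app x)
  rw [← Category.assoc, hn, Category.assoc, ← G.map_comp, h', G.map_id]
  exact Category.comp_id _

/-- The comparison `G' ⟶ G' F G ⟶ G` takes the counit `ε` to `ε'`, by the left triangle identity for
`η` and `ε`. -/
lemma map_comparison_comp_counit_app
    (h : ∀ x, F.map (η.app x) ≫ ε.app (F.obj x) = 𝟙 (F.obj x)) (y : D) :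
    F.map (η.app (G'.obj y) ≫ G.map (ε'.app y)) ≫ ε.app y = ε'.app y := by
  have hn : F.map (G.map (ε'.app y)) ≫ ε.app y = ε.app (F.obj (G'.obj y)) ≫ ε'.app y :=
    ε.naturality (ε'.app y)
  rw [F.map_comp, Category.assoc, hn, ← Category.assoc]
  exact (congrArg (· ≫ ε'.app y) (h (G'.obj y))).trans (Category.id_comp _)

end

/-! ### Global univalence -/

namespace EnrichCat

variable {X Y : EnrichCat.{w₁, v₁, u₁, w, v, u} V}

/-- The underlying natural transformation of the unit of an adjoint equivalence. -/
def unitNatTrans {F : UF.EnrichedFunctor X Y} {G : UF.EnrichedFunctor Y X}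
    (η : 𝟙 X ≅ (show X ⟶ Y from F) ≫ (show Y ⟶ X from G)) :
    𝟭 X.carrier ⟶ F.toFunctor ⋙ G.toFunctor :=
  η.hom.toNatTrans

/-- The underlying natural transformation of the counit of an adjoint equivalence. -/
def counitNatTrans {F : UF.EnrichedFunctor X Y} {G : UF.EnrichedFunctor Y X}
    (ε : (show Y ⟶ X from G) ≫ (show X ⟶ Y from F) ≅ 𝟙 Y) :
    G.toFunctor ⋙ F.toFunctor ⟶ 𝟭 Y.carrier :=
  ε.hom.toNatTrans

lemma leftTriangle_app {F : UF.EnrichedFunctor X Y} {G : UF.EnrichedFunctor Y X}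
    {η : 𝟙 X ≅ (show X ⟶ Y from F) ≫ (show Y ⟶ X from G)}
    {ε : (show Y ⟶ X from G) ≫ (show X ⟶ Y from F) ≅ 𝟙 Y}
    (h : Bicategory.leftZigzagIso η ε = Bicategory.leftUnitor _ ≪≫ (Bicategory.rightUnitor _).symm)
    (x : X.carrier) :
    F.map ((unitNatTrans η).app x) ≫ (counitNatTrans ε).app (F.obj x) = 𝟙 (F.obj x) := by
  have h' : F.map ((unitNatTrans η).app x) ≫ 𝟙 (F.obj (G.obj (F.obj x))) ≫
      (counitNatTrans ε).app (F.obj x) = 𝟙 (F.obj x) ≫ 𝟙 (F.obj x) :=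
    congrArg (fun σ : EnrichedTransformation _ _ => σ.app x)
      ((Ident.leftZigzag_eq _ _).symm.trans (congrArg Iso.hom h))
  rw [Category.comp_id] at h'
  exact (congrArg (_ ≫ ·) (Category.id_comp _)).symm.trans h'

namespace Ident

section

variable (hV : IsUnivalentCategory V) (F : UF.EnrichedFunctor X Y) [F.toFunctor.IsEquivalence]
  [∀ x y, IsIso (F.emap x y)]

/-- The identification of enriched categories given by an enriched functor that is an equivalence of
categories and invertible on hom-objects. -/
noncomputable def ofEnrichedFunctor : Ident X Y where
  toPathFunctor := F.toPathFunctor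
  isEquivalence := F.isEquivalence_onPoints
  bijective x y := ⟨F.toFunctor.map_injective, F.toFunctor.map_surjective⟩
  homId x y := hV.homToId (F.emap x y)
  homId_natural p q := hV.idToHom_injective (by
    simpa using (F.emap_homPath p q).symm)
  eid_transport x := by simpa using F.eid_emap x
  ecomp_transport x y z := by simpa using F.ecomp_emap x y z
  fromArr_transport f := by simpa using (F.fromArr_map f).symm

lemma toEnrichedFunctor_ofEnrichedFunctor : (ofEnrichedFunctor hV F).toEnrichedFunctor = F := by
  have h : (fun x y => idToHom (hV.homToId (F.emap x y))) = F.emap :=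
    funext fun x => funext fun y => hV.idToHom_homToId (F.emap x y)
  cases F
  simp only [toEnrichedFunctor, ofEnrichedFunctor]
  congr

end

/-- Adjoint equivalences are identified if their underlying 1-cells agree: the inverses are compared
by `g' ⟶ g' f g ⟶ g`, of which only the unit of the one and the counit of the other are needed, and
the compatibility with units and counits follows from the left triangle identities. -/
lemma nonempty_ident_of_hom_eq (e e' : Bicategory.Equivalence X Y) (h : e'.hom = e.hom) :
    Nonempty ((⟨e'⟩ : AdjEquiv X Y) ⟶ ⟨e⟩) := by
  obtain ⟨(F : UF.EnrichedFunctor X Y), (G : UF.EnrichedFunctor Y X), η, ε, hl⟩ := e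
  obtain ⟨_, (G' : UF.EnrichedFunctor Y X), η', ε', hl'⟩ := e'
  obtain rfl : _ = F := h
  let τ : (show Y ⟶ X from G') ≅ (show Y ⟶ X from G) :=
    (Bicategory.rightUnitor _).symm ≪≫ Bicategory.whiskerLeftIso _ η ≪≫
      (Bicategory.associator _ _ _).symm ≪≫ Bicategory.whiskerRightIso ε' _ ≪≫
      Bicategory.leftUnitor _
  obtain ⟨t, ht⟩ := (EnrichedFunctor.isUnivalentCategory Y X ⟨G'⟩ ⟨G⟩).2 τ
  have hτ (y : Y.carrier) : idToHom (EnrichedFunctor.Ident.app t y) =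
      (unitNatTrans η).app (G'.obj y) ≫ G.map ((counitNatTrans ε').app y) := by
    refine (congrArg (fun σ : G' ≅ G => σ.hom.app y) ht).trans ?_
    change 𝟙 (G'.obj y) ≫ (unitNatTrans η).app (G'.obj y) ≫ 𝟙 (G.obj _) ≫
      G.map ((counitNatTrans ε').app y) ≫ 𝟙 (G.obj y) = _
    refine (Category.id_comp _).trans (congrArg (_ ≫ ·) ?_)
    exact (Category.id_comp _).trans (Category.comp_id _)
  refine ⟨⟨𝟙 _, t, ext₂ fun x => ?_, ext₂ fun y => ?_⟩⟩
  · refine Eq.trans ?_ (unit_app_comp_comparison (unitNatTrans η) (unitNatTrans η')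
      (counitNatTrans ε') (leftTriangle_app hl') x)
    refine congrArg ((unitNatTrans η').app x ≫ ·) ?_
    rw [← hτ]
    refine (congrArg (· ≫ _) ?_).trans (Category.id_comp _)
    exact (congrArg (fun f => G'.map f) (PathCategory.idToHom_id _)).trans (G'.map_id _)
  · refine Eq.trans ?_ (map_comparison_comp_counit_app (unitNatTrans η) (counitNatTrans ε)
      (counitNatTrans ε') (leftTriangle_app hl) y)
    rw [← hτ]
    refine congrArg (_ ≫ ·) ((congrArg (· ≫ _) ?_).trans (Category.id_comp _))
    exact PathCategory.idToHom_id _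

lemma homId_transport_of_emap (hV : IsUnivalentCategory V) {P Q : Ident X Y}
    (s : P.toEnrichedFunctor.Ident Q.toEnrichedFunctor) (x y : X.carrier) :
    P.homId x y ≫ Y.enr.homPath (s.app x) (s.app y) = Q.homId x y :=
  hV.idToHom_injective ((PathCategory.idToHom_comp _ _).trans (s.emap_transport x y))

theorem isEquivalence_toAdjEquiv (hV : IsUnivalentCategory V)
    (X Y : EnrichCat.{w₁, v₁, u₁, w, v, u} V) : (toAdjEquiv X Y).IsEquivalence where
  faithful := ⟨fun {P Q s t} h => Ident₂.ext
    (congrArg (fun k : AdjEquiv.Ident _ _ => EnrichedFunctor.Ident.app k.hom) h)⟩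
  full := ⟨fun {P Q} k => by
    let r : P.toEnrichedFunctor.Ident Q.toEnrichedFunctor := AdjEquiv.Ident.hom k
    let i : P.invFunctor.Ident Q.invFunctor := AdjEquiv.Ident.inv k
    let s : Ident₂ P Q :=
      { app := r.app
        natural := r.natural
        map_transport := r.map_transport
        homId_transport := homId_transport_of_emap hV r }
    refine ⟨s, AdjEquiv.Ident.ext rfl (EnrichedFunctor.Ident.ext (funext fun y =>
      invApp_unique s y (i.app y) (Y.univalent.idToHom_injective ?_)))⟩
    -- The component at `y` of the compatibility of `k` with the counits determines `i.app y`.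
    have h : P.map (idToHom (i.app y)) ≫ idToHom (r.app (Q.invObj y)) ≫ idToHom (Q.ε y) =
        idToHom (P.ε y) :=
      congrArg (fun σ : EnrichedTransformation _ _ => σ.app y) (AdjEquiv.Ident.counit k)
    rw [PathCategory.idToHom_comp, PathCategory.idToHom_comp, ← h]
    have h' : P.map (idToHom (i.app y)) ≫ idToHom (r.app (Q.invObj y)) =
        idToHom (r.app (P.invObj y)) ≫ idToHom (Q.mapPath (i.app y)) :=
      (r.map_transport _).trans (congrArg (_ ≫ ·) (Q.idToHom_mapPath (i.app y)).symm)
    exact (Category.assoc _ _ _).symm.trans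
      ((congrArg (· ≫ idToHom (Q.ε y)) h'.symm).trans (Category.assoc _ _ _))⟩
  essSurj := ⟨fun ⟨e⟩ => by
    let F : UF.EnrichedFunctor X Y := e.hom
    have : F.toFunctor.IsEquivalence := EnrichedFunctor.isEquivalence_toFunctor e.unit e.counit
    have (x y : X.carrier) : IsIso (F.emap x y) := EnrichedFunctor.isIso_emap e.unit e.counit x y
    obtain ⟨k⟩ := nonempty_ident_of_hom_eq e (ofEnrichedFunctor hV F).toEquivalence
      (toEnrichedFunctor_ofEnrichedFunctor hV F)
    exact ⟨ofEnrichedFunctor hV F, ⟨(Groupoid.isoEquivHom _ _).symm k⟩⟩⟩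

end Ident

end EnrichCat

end UF

theorem mainTheorem1 {V : Type u₁} [Category.{v₁} V] [MonoidalCategory V]
    [UF.PathCategory.{w₁} V] (hV : UF.IsUnivalentCategory V) :
    UF.IsUnivalentBicategory (UF.EnrichCat.{w₁, v₁, u₁, w, v, u} V) :=
  ⟨UF.EnrichedFunctor.isUnivalentCategory, UF.EnrichCat.Ident.isEquivalence_toAdjEquiv hV⟩
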